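/- Let $G$ be a finite simple graph that is outerplanar (it has an embedding in the plane, with pairwise non-crossing edges, in which every vertex lies on the boundary of the infinite face) and whose maximum degree is $\Delta(G) = 4$. Let $G^2$ be the square of $G$, the graph on $V(G)$ in which two distinct vertices are adjacent if and only if they are adjacent in $G$ or have a common neighbour in $G$. Then $\chi(G^2) \le 6$. -/

import Mathlib

/-- The square `G²` of a graph `G`: distinct vertices are adjacent if they are adjacent in `G` or
have a common neighbour in `G`. -/
def graphSquare {V : Type*} (G : SimpleGraph V) : SimpleGraph V where
  Adj u v := u ≠ v ∧ (G.Adj u v ∨ ∃ w, G.Adj u w ∧ G.Adj w v)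
  symm := ⟨fun _ _ h => ⟨h.1.symm, h.2.imp (fun a => a.symm)
    (fun ⟨w, a, b⟩ => ⟨w, b.symm, a.symm⟩)⟩⟩
  loopless := ⟨fun _ h => h.1 rfl⟩

/-- The plane; only its affine structure, its topology and its bounded sets are used. -/
abbrev Plane : Type := ℝ × ℝ

/-- `A` is a (simple) polygonal arc with end points `x` and `y`: the union of finitely many
nondegenerate line segments `[p 0, p 1], …, [p (n-1), p n]` with `p 0 = x` and `p n = y`, where
consecutive segments meet only in their common end point and all other pairs are disjoint. -/
def IsPolygonalArc (x y : Plane) (A : Set Plane) : Prop :=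
  ∃ (n : ℕ) (p : ℕ → Plane), 0 < n ∧ p 0 = x ∧ p n = y ∧
    (∀ i < n, p i ≠ p (i + 1)) ∧
    (∀ i, i + 1 < n →
      segment ℝ (p i) (p (i + 1)) ∩ segment ℝ (p (i + 1)) (p (i + 2)) = {p (i + 1)}) ∧
    (∀ i j, i + 1 < j → j < n →
      Disjoint (segment ℝ (p i) (p (i + 1))) (segment ℝ (p j) (p (j + 1)))) ∧
    A = ⋃ i ∈ Set.Iio n, segment ℝ (p i) (p (i + 1))

/-- An embedding of `G` in the plane (a drawing without crossings): vertices are distinct points,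
every edge is a polygonal arc between its ends that passes through no other vertex, and two
different edges meet only in common ends. The value of `curve` at a non-edge is irrelevant. -/
structure PlaneEmbedding {V : Type*} (G : SimpleGraph V) where
  point : V → Plane
  curve : Sym2 V → Set Plane
  point_injective : Function.Injective point
  isPolygonalArc : ∀ u v, G.Adj u v → IsPolygonalArc (point u) (point v) (curve s(u, v))
  mem_of_point_mem : ∀ e ∈ G.edgeSet, ∀ w, point w ∈ curve e → w ∈ e
  inter_subset : ∀ e ∈ G.edgeSet, ∀ f ∈ G.edgeSet, e ≠ f →
    curve e ∩ curve f ⊆ point '' {v | v ∈ e ∧ v ∈ f}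

/-- The set of all points of the plane that lie on the drawing. -/
def PlaneEmbedding.image {V : Type*} {G : SimpleGraph V} (D : PlaneEmbedding G) : Set Plane :=
  Set.range D.point ∪ ⋃ e ∈ G.edgeSet, D.curve e

/-- The infinite face: the points off the drawing whose connected component in the complement of
the drawing is unbounded. (For a finite graph the drawing is compact, so that there is exactly one
unbounded component.) -/
def PlaneEmbedding.outerFace {V : Type*} {G : SimpleGraph V} (D : PlaneEmbedding G) : Set Plane :=
  {z | z ∉ D.image ∧ ¬ Bornology.IsBounded (connectedComponentIn D.imageᶜ z)}

/-- A graph is outerplanar if it has an embedding in the plane in which every vertex lies on the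
boundary of the infinite face. -/
def IsOuterplanar {V : Type*} (G : SimpleGraph V) : Prop :=
  ∃ D : PlaneEmbedding G, ∀ v, D.point v ∈ frontier D.outerFace

/-! Outerplanarity enters only through `ThetaFree`: no two vertices are joined by three internally
disjoint paths of length at least two (`IsOuterplanar.thetaFree`). The topological input is
elementary. The total angle `polyAngle` under which a closed polyline is seen is 2π times its
winding number. It is constant on connected sets off the polyline, is zero on unbounded ones, and
jumps by 2π from the left to the right of a simple loop. So a region of constant winding number
cannot touch a simple loop from both sides. If three arcs with common ends all touched the outer
face at inner bends, two of them would be touched from the same side; one of these, followed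
backwards, and the other then form a loop touched from both sides.

The rest is combinatorial: a finite `ThetaFree` graph of maximum degree at most four has a
6-colourable square (`ThetaFree.sqColorable`). In a minimal counterexample, a vertex whose
neighbours form a clique can be removed and coloured last if it has at most five neighbours in the
square. This excludes leaves and restricts triangle apices of degree two
(`IsMinimalBad.triangle_apex`); a similar argument excludes suitable adjacent pairs of vertices of
degree two (`IsMinimalBad.false_of_pair`).

A minimal lump plays the part of an end block with cut vertex `c`. Being theta-free, it has a
Hamiltonian circuit (`IsMinimalLump.exists_hamiltonian`), and two chords of it cross only if it is a
K4, which is reducible. Otherwise take a shortest chord spanning at least three edges. The part it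
cuts off has only chords of length two. Either there are none, giving a pair of adjacent vertices of
degree two, or the degree condition at triangles spreads them along the whole part, giving a fan.
The interior of a fan is recoloured explicitly (`exists_isFanColoring`,
`IsMinimalBad.false_of_fan`). -/

/-! ### Viewing angles and winding numbers of closed polylines. -/

open Complex in
/-- The angle under which the oriented segment from `a` to `b` is seen from `q`. -/
noncomputable def viewAngle (a b q : ℂ) : ℝ := arg ((b - q) / (a - q))

/-- If the quotient were a real number `t ≤ 0`, then `q` would be the convex combination of `a` and
`b` with weights `-t / (1 - t)` and `1 / (1 - t)`. -/
theorem div_mem_slitPlane_of_notMem_segment {a b q : ℂ} (h : q ∉ segment ℝ a b) :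
    (b - q) / (a - q) ∈ Complex.slitPlane := by
  have haq : a - q ≠ 0 := by
    intro h0
    apply h
    rw [← sub_eq_zero.1 h0]
    exact left_mem_segment ℝ _ _
  by_contra hs
  rw [Complex.mem_slitPlane_iff] at hs
  push Not at hs
  obtain ⟨h1, h2⟩ := hs
  set r := (b - q) / (a - q) with hr
  have hb : b - q = r * (a - q) := by rw [hr]; field_simp
  have hr' : r = ((r.re : ℝ) : ℂ) := by
    apply Complex.ext <;> simp [h2]
  set t := r.re with ht
  have hpos : 0 < 1 - t := by linarith
  have hpos' : (1 - (t : ℂ)) ≠ 0 := by exact_mod_cast hpos.ne'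
  apply h
  refine ⟨-t / (1 - t), 1 / (1 - t), div_nonneg (by linarith) hpos.le, by positivity, by
    field_simp; ring, ?_⟩
  rw [Complex.real_smul, Complex.real_smul]
  push_cast
  rw [hr'] at hb
  field_simp
  linear_combination hb

theorem continuousAt_viewAngle {a b q : ℂ} (h : q ∉ segment ℝ a b) :
    ContinuousAt (viewAngle a b) q := by
  have hs := div_mem_slitPlane_of_notMem_segment h
  have haq : a - q ≠ 0 := by
    intro h0
    apply h
    rw [← sub_eq_zero.1 h0]
    exact left_mem_segment ℝ _ _
  unfold viewAngle
  refine ContinuousAt.comp (f := fun q => (b - q) / (a - q)) (Complex.continuousAt_arg hs) ?_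
  exact ContinuousAt.div (by fun_prop) (by fun_prop) haq

theorem viewAngle_swap {a b q : ℂ} (h : q ∉ segment ℝ a b) :
    viewAngle b a q = - viewAngle a b q := by
  have hs := div_mem_slitPlane_of_notMem_segment h
  unfold viewAngle
  rw [← inv_div, Complex.arg_inv, if_neg]
  rw [Complex.mem_slitPlane_iff_arg] at hs
  exact hs.1

/-- The direction change at a bend `a, v, b`, as seen from a point `q` near `v`. -/
noncomputable def bendAngle (a b q : ℂ) : ℝ := Complex.arg (-((b - q) / (a - q)))

theorem abs_arg_lt_pi {z : ℂ} (h : z ∈ Complex.slitPlane) : |Complex.arg z| < Real.pi := by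
  rw [abs_lt]
  exact ⟨Complex.neg_pi_lt_arg z,
    lt_of_le_of_ne (Complex.arg_le_pi z) (Complex.mem_slitPlane_iff_arg.1 h).1⟩

/-- Modulo 2π the two sides agree because the quotients multiply. All three angles lie strictly
between -π and π, which leaves two possible multiples of 2π; they distinguish the two sides of the
bend. -/
theorem viewAngle_add_viewAngle {a v b q : ℂ} (h1 : q ∉ segment ℝ a v) (h2 : q ∉ segment ℝ v b)
    (hr : -((b - q) / (a - q)) ∈ Complex.slitPlane) :
    viewAngle a v q + viewAngle v b q = bendAngle a b q + Real.pi ∨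
      viewAngle a v q + viewAngle v b q = bendAngle a b q - Real.pi := by
  have s1 := div_mem_slitPlane_of_notMem_segment h1
  have s2 := div_mem_slitPlane_of_notMem_segment h2
  have n1 := Complex.slitPlane_ne_zero s1
  have n2 := Complex.slitPlane_ne_zero s2
  have hvq : v - q ≠ 0 := by
    intro h0; rw [h0] at n1; simp at n1
  have e : ((viewAngle a v q + viewAngle v b q : ℝ) : Real.Angle) =
      ((bendAngle a b q + Real.pi : ℝ) : Real.Angle) := by
    unfold viewAngle bendAngle
    rw [Real.Angle.coe_add, Real.Angle.coe_add, ← Complex.arg_mul_coe_angle n1 n2,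
      ← Complex.arg_neg_coe_angle (Complex.slitPlane_ne_zero hr)]
    congr 2
    have : a - q ≠ 0 := by
      intro h0; rw [h0] at n1; simp at n1
    field_simp
  rw [Real.Angle.angle_eq_iff_two_pi_dvd_sub] at e
  obtain ⟨k, hk⟩ := e
  have b1 := abs_lt.1 (abs_arg_lt_pi s1)
  have b2 := abs_lt.1 (abs_arg_lt_pi s2)
  have b3 := abs_lt.1 (abs_arg_lt_pi hr)
  have hp := Real.pi_pos
  change -Real.pi < viewAngle a v q ∧ viewAngle a v q < Real.pi at b1
  change -Real.pi < viewAngle v b q ∧ viewAngle v b q < Real.pi at b2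
  change -Real.pi < bendAngle a b q ∧ bendAngle a b q < Real.pi at b3
  have k1 : (k : ℝ) < 1 := by nlinarith
  have k2 : (-2 : ℝ) < k := by nlinarith
  have k1' : k < 1 := by exact_mod_cast k1
  have k2' : -2 < k := by exact_mod_cast k2
  obtain rfl | rfl : k = 0 ∨ k = -1 := by omega
  · left; push_cast at hk; linarith
  · right; push_cast at hk; linarith

/-- The total angle under which the polyline `p 0, …, p n` is seen from `q`. -/
noncomputable def polyAngle (p : ℕ → ℂ) (n : ℕ) (q : ℂ) : ℝ :=
  ∑ j ∈ Finset.range n, viewAngle (p j) (p (j + 1)) q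

/-- The quotients telescope, so for a closed polyline the total angle is a multiple of 2π. Only the
corners have to avoid `q`: the lemma is also applied to points on a segment. -/
theorem polyAngle_coe {p : ℕ → ℂ} {n : ℕ} {q : ℂ} (h : ∀ j ≤ n, p j ≠ q) :
    (polyAngle p n q : Real.Angle) = Complex.arg ((p n - q) / (p 0 - q)) := by
  induction n with
  | zero =>
    have : p 0 - q ≠ 0 := sub_ne_zero.2 (h 0 le_rfl)
    simp [polyAngle, this]
  | succ n ih =>
    have h0 : p 0 - q ≠ 0 := sub_ne_zero.2 (h 0 (by omega))
    have h1 : p n - q ≠ 0 := sub_ne_zero.2 (h n (by omega))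
    have h2 : p (n + 1) - q ≠ 0 := sub_ne_zero.2 (h _ (by omega))
    have := ih (fun j hj => h j (by omega))
    unfold polyAngle at this ⊢
    rw [Finset.sum_range_succ, Real.Angle.coe_add, this, viewAngle,
      ← Complex.arg_mul_coe_angle (div_ne_zero h1 h0) (div_ne_zero h2 h1)]
    congr 2
    field_simp

/-- Distinct segments of the polyline `p 0, …, p n` meet only if they are consecutive, and then
only in their common end; the first and the last segment may meet arbitrarily. -/
structure IsSimpleLoop (p : ℕ → ℂ) (n : ℕ) : Prop where
  ne : ∀ i < n, p i ≠ p (i + 1)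
  inter : ∀ i j, i < j → j < n → ∀ z ∈ segment ℝ (p i) (p (i + 1)),
    z ∈ segment ℝ (p j) (p (j + 1)) → (j = i + 1 ∧ z = p j) ∨ (i = 0 ∧ j + 1 = n)

theorem IsSimpleLoop.bend_notMem {p : ℕ → ℂ} {n : ℕ} (h : IsSimpleLoop p n) {k j : ℕ}
    (hk : k + 1 < n) (hj : j < n) (h1 : j ≠ k) (h2 : j ≠ k + 1) :
    p (k + 1) ∉ segment ℝ (p j) (p (j + 1)) := by
  intro hz
  have ha := right_mem_segment ℝ (p k) (p (k + 1))
  have hb := left_mem_segment ℝ (p (k + 1)) (p (k + 1 + 1))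
  rcases lt_or_gt_of_ne h1 with hlt | hgt
  · rcases h.inter j k hlt (by omega) _ hz ha with ⟨_, h4⟩ | h4
    · exact h.ne k (by omega) h4.symm
    · rcases h.inter j (k + 1) (by omega) (by omega) _ hz hb with h5 | h5 <;> omega
  · have : k + 1 < j := by omega
    rcases h.inter (k + 1) j this hj _ hb hz with ⟨h3, h4⟩ | h4
    · subst h3
      exact h.ne (k + 1) (by omega) h4
    · omega

theorem IsSimpleLoop.openSegment_notMem {p : ℕ → ℂ} {n : ℕ} (h : IsSimpleLoop p n) {k j : ℕ}
    (hk0 : 0 < k) (hk : k + 1 < n) (hj : j < n) (h1 : j ≠ k) {z : ℂ}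
    (hz : z ∈ openSegment ℝ (p k) (p (k + 1))) :
    z ∉ segment ℝ (p j) (p (j + 1)) := by
  intro hzj
  have hne := h.ne k (by omega)
  have hzk := openSegment_subset_segment ℝ _ _ hz
  rcases lt_or_gt_of_ne h1 with hlt | hgt
  · rcases h.inter j k hlt (by omega) _ hzj hzk with ⟨_, h4⟩ | h4
    · subst h4
      exact hne (left_mem_openSegment_iff.1 hz)
    · omega
  · rcases h.inter k j hgt hj _ hzk hzj with ⟨h3, h4⟩ | h4
    · subst h3; subst h4
      exact hne (right_mem_openSegment_iff.1 hz)
    · omega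

/-- Otherwise `b - v` is a positive multiple of `a - v`, and the two segments share an initial
piece. -/
theorem neg_div_mem_slitPlane {a v b : ℂ} (hav : a ≠ v) (hvb : v ≠ b)
    (h : ∀ z ∈ segment ℝ a v, z ∈ segment ℝ v b → z = v) :
    -((b - v) / (a - v)) ∈ Complex.slitPlane := by
  have hd : a - v ≠ 0 := sub_ne_zero.2 hav
  set r := (b - v) / (a - v) with hr
  have hb : b - v = r * (a - v) := by rw [hr]; field_simp
  by_contra hs
  rw [Complex.mem_slitPlane_iff] at hs
  push Not at hs
  obtain ⟨h1, h2⟩ := hs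
  simp only [Complex.neg_re, Complex.neg_im] at h1 h2
  have h2 : r.im = 0 := by linarith
  have hr' : r = ((r.re : ℝ) : ℂ) := by
    apply Complex.ext <;> simp [h2]
  set t := r.re with ht
  have ht0 : t ≠ 0 := by
    intro h0
    rw [hr', h0] at hb
    simp only [Complex.ofReal_zero, zero_mul] at hb
    exact hvb (sub_eq_zero.1 hb).symm
  have htpos : 0 < t := lt_of_le_of_ne (by linarith) (Ne.symm ht0)
  -- The nearer to `v` of the two ends `a` and `b = v + t * (a - v)`.
  set z := v + ((min 1 t : ℝ) : ℂ) * (a - v) with hz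
  have hm : 0 < min 1 t := lt_min one_pos htpos
  have hz1 : z ∈ segment ℝ a v := by
    refine ⟨min 1 t, 1 - min 1 t, hm.le, by linarith [min_le_left 1 t], by ring, ?_⟩
    rw [Complex.real_smul, Complex.real_smul, hz]
    push_cast; ring
  have hz2 : z ∈ segment ℝ v b := by
    have hle : min 1 t / t ≤ 1 := by rw [div_le_one htpos]; exact min_le_right _ _
    refine ⟨1 - min 1 t / t, min 1 t / t, by linarith, by positivity, by ring, ?_⟩
    rw [Complex.real_smul, Complex.real_smul, hz]
    have hpk : b = v + t * (a - v) := by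
      rw [← hr', ← hb]; ring
    rw [hpk]
    have : (t : ℂ) ≠ 0 := by exact_mod_cast ht0
    push_cast
    field_simp
    ring
  have h4 := h z hz1 hz2
  rw [hz, add_eq_left, mul_eq_zero] at h4
  rcases h4 with h4 | h4
  · exact hm.ne' (by exact_mod_cast h4)
  · exact hd h4

theorem IsSimpleLoop.bend_slitPlane {p : ℕ → ℂ} {n : ℕ} (h : IsSimpleLoop p n) {k : ℕ}
    (hn : 2 < n) (hk : k + 1 < n) :
    -((p (k + 2) - p (k + 1)) / (p k - p (k + 1))) ∈ Complex.slitPlane := by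
  refine neg_div_mem_slitPlane (h.ne k (by omega)) (h.ne (k + 1) hk) fun z hz1 hz2 => ?_
  rcases h.inter k (k + 1) (by omega) hk z hz1 hz2 with ⟨_, h4⟩ | h4
  · exact h4
  · omega

/-- The total angle of a polyline at points near the bend `p (k + 1)` on its left-hand side. -/
noncomputable def leftAngle (p : ℕ → ℂ) (n k : ℕ) (q : ℂ) : ℝ :=
  ∑ j ∈ ((Finset.range n).erase k).erase (k + 1), viewAngle (p j) (p (j + 1)) q +
    bendAngle (p k) (p (k + 2)) q + Real.pi

theorem continuousAt_bendAngle {a b v : ℂ} (h : -((b - v) / (a - v)) ∈ Complex.slitPlane) :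
    ContinuousAt (bendAngle a b) v := by
  unfold bendAngle
  have : a - v ≠ 0 := by
    intro h0
    rw [h0] at h
    simp [Complex.slitPlane] at h
  refine ContinuousAt.comp (f := fun q => -((b - q) / (a - q))) (Complex.continuousAt_arg h) ?_
  exact (ContinuousAt.div (by fun_prop) (by fun_prop) this).neg

theorem IsSimpleLoop.continuousAt_leftAngle {p : ℕ → ℂ} {n : ℕ} (h : IsSimpleLoop p n) {k : ℕ}
    (hn : 2 < n) (hk : k + 1 < n) : ContinuousAt (leftAngle p n k) (p (k + 1)) := by
  unfold leftAngle
  refine ((tendsto_finsetSum _ fun j hj => ?_).add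
    (continuousAt_bendAngle (h.bend_slitPlane hn hk))).add continuousAt_const
  simp only [Finset.mem_erase, Finset.mem_range] at hj
  exact continuousAt_viewAngle (h.bend_notMem hk hj.2.2 hj.2.1 hj.1)

theorem polyAngle_eq_erase {p : ℕ → ℂ} {n k : ℕ} (hk : k + 1 < n) (q : ℂ) :
    polyAngle p n q = ∑ j ∈ ((Finset.range n).erase k).erase (k + 1),
      viewAngle (p j) (p (j + 1)) q +
        (viewAngle (p k) (p (k + 1)) q + viewAngle (p (k + 1)) (p (k + 2)) q) := by
  unfold polyAngle
  rw [← Finset.add_sum_erase _ _ (Finset.mem_range.2 (show k < n by omega)),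
    ← Finset.add_sum_erase _ _ (Finset.mem_erase.2
      ⟨show k + 1 ≠ k by omega, Finset.mem_range.2 hk⟩)]
  ring

theorem arg_eq_arg_of_pos_mul {x y : ℂ} {t : ℝ} (ht : 0 < t) (h : x = t * y) :
    Complex.arg x = Complex.arg y := by
  rw [h, Complex.arg_real_mul _ ht]

/-- Here `b - q` is a negative multiple of `a - q`. As `arg` is π on the negative axis, points on
the segment itself are counted to its left-hand side. -/
theorem viewAngle_openSegment {a b q : ℂ} (hab : a ≠ b) (hq : q ∈ openSegment ℝ a b) :
    viewAngle a b q = Real.pi ∧ (∀ c, viewAngle c a q = bendAngle c b q) ∧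
      ∀ c, viewAngle b c q = bendAngle a c q := by
  obtain ⟨s, t, hs, ht, hst, rfl⟩ := hq
  have hd : a - b ≠ 0 := sub_ne_zero.2 hab
  have hsum : (s : ℂ) + t = 1 := by exact_mod_cast hst
  simp only [viewAngle, bendAngle, Complex.real_smul]
  have hs' : (s : ℂ) ≠ 0 := by exact_mod_cast hs.ne'
  have ht' : (t : ℂ) ≠ 0 := by exact_mod_cast ht.ne'
  have e1 : b - (s * a + t * b) = - s * (a - b) := by linear_combination -b * hsum
  have e2 : a - (s * a + t * b) = t * (a - b) := by linear_combination -a * hsum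
  refine ⟨?_, fun c => ?_, fun c => ?_⟩
  · rw [e1, e2, Complex.arg_eq_pi_iff]
    have : -(s : ℂ) * (a - b) / (t * (a - b)) = ((-(s / t) : ℝ) : ℂ) := by
      push_cast; field_simp
    rw [this]
    simp only [Complex.ofReal_re, Complex.ofReal_im, and_true]
    have := div_pos hs ht
    linarith
  · refine arg_eq_arg_of_pos_mul (t := t / s) (by positivity) ?_
    rw [e1, e2]
    push_cast
    by_cases hc : c - (s * a + t * b) = 0
    · rw [hc]; simp
    · field_simp
  · rw [e1, e2]
    refine arg_eq_arg_of_pos_mul (t := t / s) (by positivity) ?_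
    push_cast
    field_simp

theorem IsPreconnected.eq_of_forall_mem_lattice {X : Type*} [TopologicalSpace X] {U : Set X}
    (hU : IsPreconnected U) {f : X → ℝ} (hf : ContinuousOn f U) {T : ℝ} (hT : 0 < T)
    (hint : ∀ q ∈ U, ∃ m : ℤ, f q = T * m) {x y : X} (hx : x ∈ U) (hy : y ∈ U) : f x = f y := by
  have key : ∀ x ∈ U, ∀ y ∈ U, ¬ f x < f y := by
    intro x hx y hy hlt
    obtain ⟨m, hm⟩ := hint x hx
    obtain ⟨m', hm'⟩ := hint y hy
    have hmm : m < m' := by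
      have : (m : ℝ) < m' := by
        by_contra hc
        nlinarith
      exact_mod_cast this
    have hmm' : (m : ℝ) + 1 ≤ m' := by exact_mod_cast hmm
    have hmem : T * m + T / 2 ∈ f '' U :=
      (hU.image f hf).ordConnected.out ⟨x, hx, rfl⟩ ⟨y, hy, rfl⟩
        ⟨by rw [hm]; linarith, by rw [hm']; nlinarith⟩
    obtain ⟨z, hz, hze⟩ := hmem
    obtain ⟨k, hk⟩ := hint z hz
    rw [hk] at hze
    have h1 : (m : ℝ) < k := by nlinarith
    have h2 : (k : ℝ) < m + 1 := by nlinarith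
    have h1' : m < k := by exact_mod_cast h1
    have h2' : k < m + 1 := by exact_mod_cast h2
    omega
  exact le_antisymm (not_lt.1 (key y hy x hx)) (not_lt.1 (key x hx y hy))

theorem ContinuousAt.eq_of_frequently_eq {X Y : Type*} [TopologicalSpace X] [TopologicalSpace Y]
    [T1Space Y] {f : X → Y} {x : X} {c : Y} (hf : ContinuousAt f x)
    (h : ∃ᶠ y in nhds x, f y = c) : f x = c := by
  by_contra hne
  exact h (hf.eventually_ne hne)

/-- On the open segment between the two bends the total angle equals both left angles. It is
continuous along this segment and a multiple of 2π, hence constant, and the left angles at the bends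
are its limits. -/
theorem IsSimpleLoop.leftAngle_succ {p : ℕ → ℂ} {n : ℕ} (h : IsSimpleLoop p n) (hcl : p n = p 0)
    {k : ℕ} (hn : 2 < n) (hk : k + 2 < n) :
    leftAngle p n k (p (k + 1)) = leftAngle p n (k + 1) (p (k + 2)) := by
  have hne := h.ne (k + 1) (by omega)
  set U := openSegment ℝ (p (k + 1)) (p (k + 2)) with hU
  have hview : ∀ q ∈ U, viewAngle (p (k + 1)) (p (k + 2)) q = Real.pi ∧ _ ∧ _ :=
    fun q hq => viewAngle_openSegment hne hq
  have e1 : ∀ q ∈ U, polyAngle p n q = leftAngle p n k q := by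
    intro q hq
    obtain ⟨a1, a2, a3⟩ := hview q hq
    rw [polyAngle_eq_erase (k := k) (by omega), a1, leftAngle, a2]
    ring
  have e2 : ∀ q ∈ U, polyAngle p n q = leftAngle p n (k + 1) q := by
    intro q hq
    obtain ⟨a1, a2, a3⟩ := hview q hq
    rw [polyAngle_eq_erase (k := k + 1) (by omega), a1, leftAngle, a3]
    ring
  have hoff : ∀ q ∈ U, ∀ j < n, j ≠ k + 1 → q ∉ segment ℝ (p j) (p (j + 1)) :=
    fun q hq j hj hj' => h.openSegment_notMem (by omega) (by omega) hj hj' hq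
  -- The term of this segment is discontinuous in the plane, but along the segment it is constantly
  -- π.
  have hcont : ContinuousOn (polyAngle p n) U := by
    have : ContinuousOn (leftAngle p n k) U := by
      have : ContinuousOn (fun q => ∑ j ∈ (Finset.range n).erase (k + 1),
          viewAngle (p j) (p (j + 1)) q + Real.pi) U := by
        refine ContinuousOn.add (continuousOn_finsetSum _ fun j hj q hq => ?_) continuousOn_const
        simp only [Finset.mem_erase, Finset.mem_range] at hj
        exact (continuousAt_viewAngle (hoff q hq j hj.2 hj.1)).continuousWithinAt
      refine this.congr fun q hq => ?_
      rw [← e1 q hq, polyAngle,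
        ← Finset.add_sum_erase _ _ (Finset.mem_range.2 (show k + 1 < n by omega)),
        (hview q hq).1]
      ring
    exact this.congr e1
  have hint : ∀ q ∈ U, ∃ m : ℤ, polyAngle p n q = 2 * Real.pi * m := by
    intro q hq
    have hpq : ∀ j ≤ n, p j ≠ q := by
      intro j hj hjq
      have h0 : ∀ j < n, p j ≠ q := by
        intro j hj hjq
        by_cases hjk : j = k + 1
        · subst hjk
          rw [← hjq] at hq
          exact hne (left_mem_openSegment_iff.1 hq)
        · apply hoff q hq j hj hjk
          rw [← hjq]
          exact left_mem_segment ℝ _ _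
      rcases hj.lt_or_eq with hj | hj
      · exact h0 j hj hjq
      · subst hj
        rw [hcl] at hjq
        exact h0 0 (by omega) hjq
    have := polyAngle_coe hpq
    rw [hcl, div_self (sub_ne_zero.2 (hpq 0 (by omega))), Complex.arg_one,
      Real.Angle.angle_eq_iff_two_pi_dvd_sub] at this
    simpa using this
  have hpre : IsPreconnected U := (convex_openSegment _ _).isPreconnected
  have hconst : ∀ q ∈ U, ∀ q' ∈ U, polyAngle p n q = polyAngle p n q' := by
    intro q hq q' hq'
    exact hpre.eq_of_forall_mem_lattice hcont Real.two_pi_pos hint hq hq'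
  obtain ⟨q₀, hq₀⟩ : U.Nonempty := ⟨_, midpoint_mem_openSegment (𝕜 := ℝ) _ _⟩
  have lim : ∀ (f : ℂ → ℝ) (x : ℂ), ContinuousAt f x → x ∈ segment ℝ (p (k + 1)) (p (k + 2)) →
      (∀ q ∈ U, polyAngle p n q = f q) → f x = polyAngle p n q₀ := by
    intro f x hf hx hfU
    refine hf.eq_of_frequently_eq ?_
    have := mem_closure_iff_frequently.1 (segment_subset_closure_openSegment hx)
    refine this.mono fun q hq => ?_
    rw [← hfU q hq, hconst q hq q₀ hq₀]
  rw [lim _ _ (h.continuousAt_leftAngle hn (by omega)) (left_mem_segment ℝ _ _) e1,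
    lim _ _ (h.continuousAt_leftAngle hn (by omega)) (right_mem_segment ℝ _ _) e2]

theorem IsSimpleLoop.leftAngle_eq {p : ℕ → ℂ} {n : ℕ} (h : IsSimpleLoop p n) (hcl : p n = p 0)
    (hn : 2 < n) {k l : ℕ} (hk : k + 1 < n) (hl : l + 1 < n) :
    leftAngle p n k (p (k + 1)) = leftAngle p n l (p (l + 1)) := by
  have : ∀ k, k + 1 < n → leftAngle p n k (p (k + 1)) = leftAngle p n 0 (p (0 + 1)) := by
    intro k hk
    induction k with
    | zero => rfl
    | succ k ih => rw [← ih (by omega), h.leftAngle_succ hcl hn hk]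
  rw [this k hk, this l hl]

/-- The point `q` lies on the left (near `v`) of the polyline `a, v, b`. -/
def OnLeft (a v b q : ℂ) : Prop := viewAngle a v q + viewAngle v b q = bendAngle a b q + Real.pi

/-- The point `q` lies on the right (near `v`) of the polyline `a, v, b`. -/
def OnRight (a v b q : ℂ) : Prop := viewAngle a v q + viewAngle v b q = bendAngle a b q - Real.pi

theorem eventually_onLeft_or_onRight {a v b : ℂ}
    (h : -((b - v) / (a - v)) ∈ Complex.slitPlane) :
    ∀ᶠ q in nhds v, q ∉ segment ℝ a v → q ∉ segment ℝ v b → OnLeft a v b q ∨ OnRight a v b q := by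
  have hav : a - v ≠ 0 := by
    intro h0
    rw [h0] at h
    simp [Complex.slitPlane] at h
  have hc : ContinuousAt (fun q => -((b - q) / (a - q))) v :=
    (ContinuousAt.div (by fun_prop) (by fun_prop) hav).neg
  filter_upwards [hc.eventually (Complex.isOpen_slitPlane.mem_nhds h)] with q hq h1 h2
  exact viewAngle_add_viewAngle h1 h2 hq

/-- Reversing the polyline changes the sign of every angle involved. -/
theorem eventually_onRight_swap {a v b : ℂ} (h : -((b - v) / (a - v)) ∈ Complex.slitPlane) :
    ∀ᶠ q in nhds v, q ∉ segment ℝ a v → q ∉ segment ℝ v b →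
      (OnLeft a v b q → OnRight b v a q) ∧ (OnRight a v b q → OnLeft b v a q) := by
  have hav : a - v ≠ 0 := by
    intro h0
    rw [h0] at h
    simp [Complex.slitPlane] at h
  have hc : ContinuousAt (fun q => -((b - q) / (a - q))) v :=
    (ContinuousAt.div (by fun_prop) (by fun_prop) hav).neg
  filter_upwards [hc.eventually (Complex.isOpen_slitPlane.mem_nhds h)] with q hq h1 h2
  have e : bendAngle b a q = - bendAngle a b q := by
    unfold bendAngle
    rw [← inv_div, ← inv_neg, Complex.arg_inv, if_neg (Complex.mem_slitPlane_iff_arg.1 hq).1]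
  unfold OnLeft OnRight
  rw [e, viewAngle_swap h1, viewAngle_swap h2]
  constructor <;> intro h3 <;> linarith

theorem IsSimpleLoop.leftAngle_of_frequently_onLeft {p : ℕ → ℂ} {n : ℕ} (h : IsSimpleLoop p n)
    (hn : 2 < n) {k : ℕ} (hk : k + 1 < n) {c : ℝ}
    (hf : ∃ᶠ q in nhds (p (k + 1)), polyAngle p n q = c ∧ OnLeft (p k) (p (k + 1)) (p (k + 2)) q) :
    leftAngle p n k (p (k + 1)) = c := by
  refine (h.continuousAt_leftAngle hn hk).eq_of_frequently_eq (hf.mono ?_)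
  rintro q ⟨hq, hl⟩
  rw [← hq, polyAngle_eq_erase hk, hl, leftAngle]
  ring

/-- `OnLeft` and `OnRight` differ by 2π, so the winding number drops by one from left to right. -/
theorem IsSimpleLoop.leftAngle_of_frequently_onRight {p : ℕ → ℂ} {n : ℕ} (h : IsSimpleLoop p n)
    (hn : 2 < n) {k : ℕ} (hk : k + 1 < n) {c : ℝ}
    (hf : ∃ᶠ q in nhds (p (k + 1)),
      polyAngle p n q = c ∧ OnRight (p k) (p (k + 1)) (p (k + 2)) q) :
    leftAngle p n k (p (k + 1)) = c + 2 * Real.pi := by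
  refine (h.continuousAt_leftAngle hn hk).eq_of_frequently_eq (hf.mono ?_)
  rintro q ⟨hq, hl⟩
  rw [← hq, polyAngle_eq_erase hk, hl, leftAngle]
  ring

/-- A region on which the winding number of a simple loop is constant does not touch the loop
from both sides. -/
theorem IsSimpleLoop.false_of_onLeft_of_onRight {p : ℕ → ℂ} {n : ℕ} (h : IsSimpleLoop p n)
    (hcl : p n = p 0) (hn : 2 < n) {k l : ℕ} (hk : k + 1 < n) (hl : l + 1 < n) {c : ℝ}
    (hL : ∃ᶠ q in nhds (p (k + 1)), polyAngle p n q = c ∧ OnLeft (p k) (p (k + 1)) (p (k + 2)) q)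
    (hR : ∃ᶠ q in nhds (p (l + 1)),
      polyAngle p n q = c ∧ OnRight (p l) (p (l + 1)) (p (l + 2)) q) : False := by
  have h1 := h.leftAngle_of_frequently_onLeft hn hk hL
  have h2 := h.leftAngle_of_frequently_onRight hn hl hR
  have h3 := h.leftAngle_eq hcl hn hk hl
  have := Real.pi_pos
  linarith

theorem tendsto_viewAngle_cobounded (a b : ℂ) :
    Filter.Tendsto (viewAngle a b) (Bornology.cobounded ℂ) (nhds 0) := by
  have h1 : Filter.Tendsto (fun q : ℂ => (b - q) / (a - q)) (Bornology.cobounded ℂ) (nhds 1) := by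
    have hinv : Filter.Tendsto (fun q : ℂ => (a - q)⁻¹) (Bornology.cobounded ℂ) (nhds 0) := by
      refine Filter.tendsto_inv₀_cobounded.comp ?_
      exact tendsto_const_sub_cobounded a
    have h3 : Filter.Tendsto (fun q : ℂ => 1 + (b - a) * (a - q)⁻¹) (Bornology.cobounded ℂ)
        (nhds (1 + (b - a) * 0)) := tendsto_const_nhds.add (tendsto_const_nhds.mul hinv)
    rw [mul_zero, add_zero] at h3
    refine h3.congr' ?_
    filter_upwards [Bornology.eventually_ne_cobounded a] with q hq
    have : a - q ≠ 0 := sub_ne_zero.2 hq.symm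
    field_simp
    ring
  have h2 := (Complex.continuousAt_arg Complex.one_mem_slitPlane).tendsto.comp h1
  rw [Complex.arg_one] at h2
  exact h2

theorem tendsto_polyAngle_cobounded (p : ℕ → ℂ) (n : ℕ) :
    Filter.Tendsto (polyAngle p n) (Bornology.cobounded ℂ) (nhds 0) := by
  have := tendsto_finsetSum (Finset.range n) fun j _ =>
    tendsto_viewAngle_cobounded (p j) (p (j + 1))
  simpa [polyAngle, funext_iff] using! this

/-- The winding number of a closed polyline vanishes on unbounded connected sets off it. -/
theorem polyAngle_eq_zero {p : ℕ → ℂ} {n : ℕ} (hn : 0 < n) (hcl : p n = p 0) {U : Set ℂ}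
    (hU : IsPreconnected U) (hb : ¬ Bornology.IsBounded U)
    (hoff : ∀ q ∈ U, ∀ j < n, q ∉ segment ℝ (p j) (p (j + 1))) {q : ℂ} (hq : q ∈ U) :
    polyAngle p n q = 0 := by
  have hint : ∀ q ∈ U, ∃ m : ℤ, polyAngle p n q = 2 * Real.pi * m := by
    intro q hq
    have h0 : ∀ j < n, p j ≠ q := fun j hj hjq => hoff q hq j hj (hjq ▸ left_mem_segment ℝ _ _)
    have hpq : ∀ j ≤ n, p j ≠ q := by
      intro j hj
      rcases hj.lt_or_eq with hj | rfl
      · exact h0 j hj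
      · rw [hcl]; exact h0 0 hn
    have := polyAngle_coe hpq
    rw [hcl, div_self (sub_ne_zero.2 (hpq 0 (by omega))), Complex.arg_one,
      Real.Angle.angle_eq_iff_two_pi_dvd_sub] at this
    simpa using this
  have hcont : ContinuousOn (polyAngle p n) U := by
    unfold polyAngle
    exact continuousOn_finsetSum _ fun j hj q hq =>
      (continuousAt_viewAngle (hoff q hq j (Finset.mem_range.1 hj))).continuousWithinAt
  -- The angle tends to 0 at infinity, and the only multiple of 2π below π in absolute value is 0.
  have hev : ∀ᶠ z in Bornology.cobounded ℂ, |polyAngle p n z| < Real.pi := by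
    have := (tendsto_polyAngle_cobounded p n).abs
    rw [abs_zero] at this
    exact this.eventually (gt_mem_nhds Real.pi_pos)
  obtain ⟨z, hz, hzU⟩ : ∃ z, |polyAngle p n z| < Real.pi ∧ z ∈ U := by
    by_contra hc
    push Not at hc
    apply hb
    rw [Bornology.isBounded_def]
    filter_upwards [hev] with z hz
    exact hc z hz
  rw [hU.eq_of_forall_mem_lattice hcont Real.two_pi_pos hint hq hzU]
  obtain ⟨m, hm⟩ := hint z hzU
  rw [hm, abs_lt] at hz
  have hp := Real.pi_pos
  have h1 : (m : ℝ) < 1 := by nlinarith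
  have h2 : (-1 : ℝ) < m := by nlinarith
  have h1' : m < 1 := by exact_mod_cast h1
  have h2' : -1 < m := by exact_mod_cast h2
  obtain rfl : m = 0 := by omega
  simp [hm]

/-! ### Simple arcs, their reversal and concatenation. -/

/-- `p 0, …, p n` are the successive corners of a simple polygonal arc. -/
structure IsSimpleArc (p : ℕ → ℂ) (n : ℕ) : Prop where
  pos : 0 < n
  ne : ∀ i < n, p i ≠ p (i + 1)
  inter : ∀ i j, i < j → j < n → ∀ z ∈ segment ℝ (p i) (p (i + 1)),
    z ∈ segment ℝ (p j) (p (j + 1)) → j = i + 1 ∧ z = p j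

/-- The union of the segments of a polyline. -/
def polyImage (p : ℕ → ℂ) (n : ℕ) : Set ℂ := {z | ∃ j < n, z ∈ segment ℝ (p j) (p (j + 1))}

theorem IsSimpleArc.eq_zero_of_mem {p : ℕ → ℂ} {n : ℕ} (h : IsSimpleArc p n) {i : ℕ} (hi : i < n)
    (hz : p 0 ∈ segment ℝ (p i) (p (i + 1))) : i = 0 := by
  by_contra h0
  obtain ⟨h1, h2⟩ := h.inter 0 i (by omega) hi _ (left_mem_segment ℝ _ _) hz
  subst h1
  exact h.ne 0 h.pos h2

theorem IsSimpleArc.succ_eq_of_mem {p : ℕ → ℂ} {n : ℕ} (h : IsSimpleArc p n) {i : ℕ} (hi : i < n)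
    (hz : p n ∈ segment ℝ (p i) (p (i + 1))) : i + 1 = n := by
  by_contra h0
  obtain ⟨n, rfl⟩ : ∃ k, n = k + 1 := ⟨n - 1, by omega⟩
  obtain ⟨h1, h2⟩ := h.inter i n (by omega) (by omega) _ hz (right_mem_segment ℝ _ _)
  exact h.ne n (by omega) h2.symm

/-- The polyline `p 0, …, p n` traversed backwards. -/
def polyReverse (p : ℕ → ℂ) (n : ℕ) : ℕ → ℂ := fun k => p (n - k)

theorem polyReverse_segment {p : ℕ → ℂ} {n j : ℕ} (hj : j < n) :
    segment ℝ (polyReverse p n j) (polyReverse p n (j + 1)) =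
      segment ℝ (p (n - 1 - j)) (p (n - 1 - j + 1)) := by
  unfold polyReverse
  rw [segment_symm, show n - 1 - j = n - (j + 1) by omega, show n - (j + 1) + 1 = n - j by omega]

theorem IsSimpleArc.reverse {p : ℕ → ℂ} {n : ℕ} (h : IsSimpleArc p n) :
    IsSimpleArc (polyReverse p n) n where
  pos := h.pos
  ne i hi := by
    have := h.ne (n - (i + 1)) (by omega)
    unfold polyReverse
    rw [show n - i = n - (i + 1) + 1 by omega]
    exact this.symm
  inter i j hij hj z h1 h2 := by
    rw [polyReverse_segment (by omega)] at h1 h2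
    obtain ⟨h3, h4⟩ := h.inter (n - 1 - j) (n - 1 - i) (by omega) (by omega) z h2 h1
    refine ⟨by omega, ?_⟩
    rw [h4, polyReverse]
    congr 1
    omega

theorem polyImage_reverse (p : ℕ → ℂ) (n : ℕ) : polyImage (polyReverse p n) n = polyImage p n := by
  ext z
  constructor
  · rintro ⟨j, hj, hz⟩
    rw [polyReverse_segment hj] at hz
    exact ⟨_, by omega, hz⟩
  · rintro ⟨j, hj, hz⟩
    refine ⟨n - 1 - j, by omega, ?_⟩
    rw [polyReverse_segment (by omega), show n - 1 - (n - 1 - j) = j by omega]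
    exact hz

/-- The polyline `p 0, …, p m` followed by `q 0, q 1, …`, where `p m = q 0`. -/
def polyConcat (p : ℕ → ℂ) (m : ℕ) (q : ℕ → ℂ) : ℕ → ℂ :=
  fun k => if k < m then p k else q (k - m)

theorem polyConcat_left {p : ℕ → ℂ} {m : ℕ} {q : ℕ → ℂ} (h : p m = q 0) {k : ℕ} (hk : k ≤ m) :
    polyConcat p m q k = p k := by
  unfold polyConcat
  split_ifs with h1
  · rfl
  · obtain rfl : k = m := by omega
    simp [h]

theorem polyConcat_right (p : ℕ → ℂ) (m : ℕ) (q : ℕ → ℂ) (k : ℕ) :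
    polyConcat p m q (m + k) = q k := by
  unfold polyConcat
  rw [if_neg (by omega), Nat.add_sub_cancel_left]

theorem polyConcat_right' (p : ℕ → ℂ) {m : ℕ} (q : ℕ → ℂ) {k : ℕ} (hk : m ≤ k) :
    polyConcat p m q k = q (k - m) := by
  unfold polyConcat
  rw [if_neg (by omega)]

theorem polyConcat_cases {p : ℕ → ℂ} {m : ℕ} {q : ℕ → ℂ} (h : p m = q 0) (j : ℕ) :
    (j < m ∧ polyConcat p m q j = p j ∧ polyConcat p m q (j + 1) = p (j + 1)) ∨
      (m ≤ j ∧ polyConcat p m q j = q (j - m) ∧ polyConcat p m q (j + 1) = q (j - m + 1)) := by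
  rcases lt_or_ge j m with hj | hj
  · exact Or.inl ⟨hj, polyConcat_left h hj.le, polyConcat_left h hj⟩
  · refine Or.inr ⟨hj, polyConcat_right' p q hj, ?_⟩
    rw [polyConcat_right' p q (by omega), show j + 1 - m = j - m + 1 by omega]

theorem polyImage_concat {p : ℕ → ℂ} {m : ℕ} {q : ℕ → ℂ} {n : ℕ} (h : p m = q 0) :
    polyImage (polyConcat p m q) (m + n) = polyImage p m ∪ polyImage q n := by
  ext z
  constructor
  · rintro ⟨j, hj, hz⟩
    rcases polyConcat_cases h j with ⟨h1, h2, h3⟩ | ⟨h1, h2, h3⟩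
    · rw [h2, h3] at hz
      exact Or.inl ⟨j, h1, hz⟩
    · rw [h2, h3] at hz
      exact Or.inr ⟨j - m, by omega, hz⟩
  · rintro (⟨j, hj, hz⟩ | ⟨j, hj, hz⟩)
    · refine ⟨j, by omega, ?_⟩
      rwa [polyConcat_left h hj.le, polyConcat_left h hj]
    · refine ⟨m + j, by omega, ?_⟩
      rwa [polyConcat_right, add_assoc, polyConcat_right]

theorem polyConcat_ne {p : ℕ → ℂ} {m : ℕ} {q : ℕ → ℂ} {n : ℕ} (h : p m = q 0)
    (hp : ∀ i < m, p i ≠ p (i + 1)) (hq : ∀ i < n, q i ≠ q (i + 1)) :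
    ∀ i < m + n, polyConcat p m q i ≠ polyConcat p m q (i + 1) := by
  intro i hi
  rcases polyConcat_cases h i with ⟨h1, h2, h3⟩ | ⟨h1, h2, h3⟩
  · rw [h2, h3]; exact hp i h1
  · rw [h2, h3]; exact hq _ (by omega)

theorem IsSimpleArc.concat {p : ℕ → ℂ} {m : ℕ} {q : ℕ → ℂ} {n : ℕ} (hp : IsSimpleArc p m)
    (hq : IsSimpleArc q n) (h : p m = q 0) (hpq : ∀ z ∈ polyImage p m, z ∈ polyImage q n → z = q 0) :
    IsSimpleArc (polyConcat p m q) (m + n) where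
  pos := by have := hp.pos; omega
  ne := polyConcat_ne h hp.ne hq.ne
  inter i j hij hj z h1 h2 := by
    rcases polyConcat_cases h i with ⟨a1, a2, a3⟩ | ⟨a1, a2, a3⟩ <;>
      rcases polyConcat_cases h j with ⟨b1, b2, b3⟩ | ⟨b1, b2, b3⟩ <;>
      rw [a2, a3] at h1 <;> rw [b2, b3] at h2 <;> rw [b2]
    · exact hp.inter i j hij b1 z h1 h2
    · have hz := hpq z ⟨i, a1, h1⟩ ⟨_, by omega, h2⟩
      rw [hz] at h1 h2
      have e2 := hq.eq_zero_of_mem (by omega) h2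
      rw [← h] at h1
      have e1 := hp.succ_eq_of_mem a1 h1
      exact ⟨by omega, by rw [e2, hz]⟩
    · omega
    · obtain ⟨e1, e2⟩ := hq.inter (i - m) (j - m) (by omega) (by omega) z h1 h2
      exact ⟨by omega, e2⟩

/-- The second common end `p 0` lies on the first and the last segment, the pair that `IsSimpleLoop`
exempts. -/
theorem IsSimpleArc.concat_loop {p : ℕ → ℂ} {m : ℕ} {q : ℕ → ℂ} {n : ℕ} (hp : IsSimpleArc p m)
    (hq : IsSimpleArc q n) (h : p m = q 0) (h' : q n = p 0)
    (hpq : ∀ z ∈ polyImage p m, z ∈ polyImage q n → z = q 0 ∨ z = p 0) :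
    IsSimpleLoop (polyConcat p m q) (m + n) where
  ne := polyConcat_ne h hp.ne hq.ne
  inter i j hij hj z h1 h2 := by
    rcases polyConcat_cases h i with ⟨a1, a2, a3⟩ | ⟨a1, a2, a3⟩ <;>
      rcases polyConcat_cases h j with ⟨b1, b2, b3⟩ | ⟨b1, b2, b3⟩ <;>
      rw [a2, a3] at h1 <;> rw [b2, b3] at h2 <;> rw [b2]
    · exact Or.inl (hp.inter i j hij b1 z h1 h2)
    · rcases hpq z ⟨i, a1, h1⟩ ⟨_, by omega, h2⟩ with hz | hz
      · rw [hz] at h1 h2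
        have e2 := hq.eq_zero_of_mem (by omega) h2
        rw [← h] at h1
        have e1 := hp.succ_eq_of_mem a1 h1
        exact Or.inl ⟨by omega, by rw [e2, hz]⟩
      · rw [hz] at h1 h2
        have e1 := hp.eq_zero_of_mem a1 h1
        rw [← h'] at h2
        have e2 := hq.succ_eq_of_mem (by omega) h2
        exact Or.inr ⟨e1, by omega⟩
    · omega
    · obtain ⟨e1, e2⟩ := hq.inter (i - m) (j - m) (by omega) (by omega) z h1 h2
      exact Or.inl ⟨by omega, e2⟩

theorem IsSimpleArc.bend_slitPlane {p : ℕ → ℂ} {n : ℕ} (h : IsSimpleArc p n) {k : ℕ}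
    (hk : k + 1 < n) :
    -((p (k + 2) - p (k + 1)) / (p k - p (k + 1))) ∈ Complex.slitPlane :=
  neg_div_mem_slitPlane (h.ne k (by omega)) (h.ne (k + 1) hk) fun z hz1 hz2 =>
    (h.inter k (k + 1) (by omega) hk z hz1 hz2).2

/-! ### Three arcs with common ends. -/

/-- Two arcs from `x` to `y`, disjoint apart from their ends, do not touch from the same side a
region on which the winding numbers of closed polylines vanish. -/
theorem IsSimpleArc.false_of_same_side {p q : ℕ → ℂ} {m n : ℕ} (hp : IsSimpleArc p m)
    (hq : IsSimpleArc q n) (h0 : p 0 = q 0) (h1 : p m = q n)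
    (hpq : ∀ z ∈ polyImage p m, z ∈ polyImage q n → z = p 0 ∨ z = p m)
    {O : Set ℂ} (hO : ∀ z ∈ O, z ∉ polyImage p m)
    (hW : ∀ (r : ℕ → ℂ) (N : ℕ), 0 < N → r N = r 0 → polyImage r N ⊆ polyImage p m ∪ polyImage q n →
      ∀ z ∈ O, polyAngle r N z = 0)
    {k l : ℕ} (hk : k + 1 < m) (hl : l + 1 < n)
    (hside : (∃ᶠ z in nhds (p (k + 1)), z ∈ O ∧ OnLeft (p k) (p (k + 1)) (p (k + 2)) z) ∧
        (∃ᶠ z in nhds (q (l + 1)), z ∈ O ∧ OnLeft (q l) (q (l + 1)) (q (l + 2)) z) ∨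
      (∃ᶠ z in nhds (p (k + 1)), z ∈ O ∧ OnRight (p k) (p (k + 1)) (p (k + 2)) z) ∧
        (∃ᶠ z in nhds (q (l + 1)), z ∈ O ∧ OnRight (q l) (q (l + 1)) (q (l + 2)) z)) : False := by
  -- Reversing `p` exchanges its sides, so the loop of `p'` and `q` is touched from both sides.
  set p' := polyReverse p m with hp'
  have e0 : p' 0 = p m := by simp [hp', polyReverse]
  have em : p' m = p 0 := by simp [hp', polyReverse]
  have hj : p' m = q 0 := by rw [em, h0]
  have hloop : IsSimpleLoop (polyConcat p' m q) (m + n) := by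
    refine hp.reverse.concat_loop hq hj (by rw [← h1, ← e0]) fun z hz1 hz2 => ?_
    rw [polyImage_reverse] at hz1
    rw [← h0]
    change z = p 0 ∨ z = p' 0
    rw [e0]
    exact hpq z hz1 hz2
  set r := polyConcat p' m q with hr
  have hcl : r (m + n) = r 0 := by
    rw [hr, polyConcat_right, polyConcat_left hj (by omega), e0, h1]
  have hzero : ∀ z ∈ O, polyAngle r (m + n) z = 0 := by
    refine hW r (m + n) (by omega) hcl ?_
    rw [hr, polyImage_concat hj, polyImage_reverse]
  -- The corner `p (k + 1)` has the index `d + 1` on the reversed arc.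
  obtain ⟨d, rfl⟩ : ∃ d, m = d + k + 2 := ⟨m - k - 2, by omega⟩
  have r0 : r d = p (k + 2) := by
    rw [hr, polyConcat_left hj (by omega), hp', polyReverse]; congr 1; omega
  have r1 : r (d + 1) = p (k + 1) := by
    rw [hr, polyConcat_left hj (by omega), hp', polyReverse]; congr 1; omega
  have r2 : r (d + 2) = p k := by
    rw [hr, polyConcat_left hj (by omega), hp', polyReverse]; congr 1; omega
  have s0 : r (d + k + 2 + l) = q l := by rw [hr, polyConcat_right]
  have s1 : r (d + k + 2 + l + 1) = q (l + 1) := by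
    rw [hr, add_assoc _ l, polyConcat_right]
  have s2 : r (d + k + 2 + l + 2) = q (l + 2) := by
    rw [hr, add_assoc _ l, polyConcat_right]
  have hsw := eventually_onRight_swap (hp.bend_slitPlane hk)
  have hoff : ∀ z ∈ O, z ∉ segment ℝ (p k) (p (k + 1)) ∧ z ∉ segment ℝ (p (k + 1)) (p (k + 2)) :=
    fun z hz => ⟨fun h => hO z hz ⟨k, by omega, h⟩, fun h => hO z hz ⟨k + 1, by omega, h⟩⟩
  rcases hside with ⟨ha, hb⟩ | ⟨ha, hb⟩
  · refine hloop.false_of_onLeft_of_onRight hcl (by omega) (k := d + k + 2 + l) (l := d) (c := 0)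
      (by omega) (by omega) ?_ ?_
    · rw [s0, s1, s2]
      exact hb.mono fun z hz => ⟨hzero z hz.1, hz.2⟩
    · rw [r0, r1, r2]
      exact (ha.and_eventually hsw).mono fun z hz =>
        ⟨hzero z hz.1.1, (hz.2 (hoff z hz.1.1).1 (hoff z hz.1.1).2).1 hz.1.2⟩
  · refine hloop.false_of_onLeft_of_onRight hcl (by omega) (k := d) (l := d + k + 2 + l) (c := 0)
      (by omega) (by omega) ?_ ?_
    · rw [r0, r1, r2]
      exact (ha.and_eventually hsw).mono fun z hz =>
        ⟨hzero z hz.1.1, (hz.2 (hoff z hz.1.1).1 (hoff z hz.1.1).2).2 hz.1.2⟩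
    · rw [s0, s1, s2]
      exact hb.mono fun z hz => ⟨hzero z hz.1, hz.2⟩

/-- Three arcs from `x` to `y`, disjoint apart from their ends, do not all touch a region on which
the winding numbers of closed polylines vanish. -/
theorem false_of_three_arcs {p : Fin 3 → ℕ → ℂ} {n : Fin 3 → ℕ} {x y : ℂ}
    (hp : ∀ i, IsSimpleArc (p i) (n i)) (h0 : ∀ i, p i 0 = x) (h1 : ∀ i, p i (n i) = y)
    (hpq : ∀ i j, i ≠ j → ∀ z ∈ polyImage (p i) (n i), z ∈ polyImage (p j) (n j) → z = x ∨ z = y)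
    {O : Set ℂ} (hO : ∀ i, ∀ z ∈ O, z ∉ polyImage (p i) (n i))
    (hW : ∀ (r : ℕ → ℂ) (N : ℕ), 0 < N → r N = r 0 → polyImage r N ⊆ ⋃ i, polyImage (p i) (n i) →
      ∀ z ∈ O, polyAngle r N z = 0)
    {k : Fin 3 → ℕ} (hk : ∀ i, k i + 1 < n i) (hcl : ∀ i, p i (k i + 1) ∈ closure O) : False := by
  set A : Fin 3 → Prop := fun i => ∃ᶠ z in nhds (p i (k i + 1)), z ∈ O ∧
    OnLeft (p i (k i)) (p i (k i + 1)) (p i (k i + 2)) z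
  set B : Fin 3 → Prop := fun i => ∃ᶠ z in nhds (p i (k i + 1)), z ∈ O ∧
    OnRight (p i (k i)) (p i (k i + 1)) (p i (k i + 2)) z
  have hside : ∀ i, A i ∨ B i := by
    intro i
    have ha := (mem_closure_iff_frequently.1 (hcl i)).and_eventually
      (eventually_onLeft_or_onRight ((hp i).bend_slitPlane (hk i)))
    rw [← Filter.frequently_or_distrib]
    refine ha.mono fun z hz => ?_
    have hh := hz.2 (fun h => hO i z hz.1 ⟨k i, by have := hk i; omega, h⟩)
      (fun h => hO i z hz.1 ⟨k i + 1, hk i, h⟩)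
    exact hh.imp (fun h => ⟨hz.1, h⟩) (fun h => ⟨hz.1, h⟩)
  have hno : ∀ i j, i ≠ j → ¬ ((A i ∧ A j) ∨ (B i ∧ B j)) := by
    intro i j hij hs
    refine (hp i).false_of_same_side (hp j) (by rw [h0, h0]) (by rw [h1, h1]) ?_ (hO i) ?_ (hk i)
      (hk j) hs
    · rw [h0, h1]; exact hpq i j hij
    · intro r N hN hr hsub
      refine hW r N hN hr (hsub.trans ?_)
      exact Set.union_subset (Set.subset_iUnion (fun i => polyImage (p i) (n i)) i)
        (Set.subset_iUnion (fun i => polyImage (p i) (n i)) j)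
  -- Three arcs and two sides: some two arcs are touched from the same side.
  have := hside 0
  have := hside 1
  have := hside 2
  have := hno 0 1 (by decide)
  have := hno 0 2 (by decide)
  have := hno 1 2 (by decide)
  tauto

/-! ### From outerplanar drawings to theta-free graphs. -/

/-- No two vertices are joined by three internally disjoint paths of length at least two. -/
def ThetaFree {V : Type*} (G : SimpleGraph V) : Prop :=
  ∀ (x y : V) (l₁ l₂ l₃ : List V), l₁ ≠ [] → l₂ ≠ [] → l₃ ≠ [] →
    List.IsChain G.Adj (x :: l₁ ++ [y]) → List.IsChain G.Adj (x :: l₂ ++ [y]) →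
    List.IsChain G.Adj (x :: l₃ ++ [y]) → ¬ (x :: y :: (l₁ ++ l₂ ++ l₃)).Nodup

/-- The identification of `Plane` with the complex plane. -/
noncomputable def planeEquiv : Plane ≃L[ℝ] ℂ := Complex.equivRealProdCLM.symm

theorem planeEquiv_symm_mem_segment {a b : Plane} {z : ℂ} :
    z ∈ segment ℝ (planeEquiv a) (planeEquiv b) ↔ planeEquiv.symm z ∈ segment ℝ a b := by
  have := image_segment ℝ planeEquiv.toLinearMap.toAffineMap a b
  have h2 : planeEquiv '' segment ℝ a b = segment ℝ (planeEquiv a) (planeEquiv b) := this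
  rw [← h2]
  constructor
  · rintro ⟨w, hw, rfl⟩
    simpa using hw
  · intro h
    exact ⟨_, h, by simp⟩

theorem IsPolygonalArc.exists_isSimpleArc {x y : Plane} {A : Set Plane} (h : IsPolygonalArc x y A) :
    ∃ (n : ℕ) (p : ℕ → ℂ), IsSimpleArc p n ∧ p 0 = planeEquiv x ∧ p n = planeEquiv y ∧
      ∀ z ∈ polyImage p n, planeEquiv.symm z ∈ A := by
  obtain ⟨n, p, hn, h0, h1, hne, hadj, hdis, rfl⟩ := h
  refine ⟨n, fun k => planeEquiv (p k), ⟨hn, fun i hi h => hne i hi (planeEquiv.injective h), ?_⟩,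
    congrArg _ h0, congrArg _ h1, ?_⟩
  · intro i j hij hj z hz1 hz2
    rw [planeEquiv_symm_mem_segment] at hz1 hz2
    rcases Nat.lt_or_ge (i + 1) j with h | h
    · exact absurd hz2 (Set.disjoint_left.1 (hdis i j h hj) hz1)
    · obtain rfl : j = i + 1 := by omega
      have : planeEquiv.symm z ∈ ({p (i + 1)} : Set Plane) := by
        rw [← hadj i hj]; exact ⟨hz1, hz2⟩
      refine ⟨rfl, ?_⟩
      rw [← Set.mem_singleton_iff.1 this]
      simp
  · rintro z ⟨j, hj, hz⟩
    rw [planeEquiv_symm_mem_segment] at hz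
    exact Set.mem_biUnion (Set.mem_Iio.2 hj) hz

namespace PlaneEmbedding

variable {V : Type*} {G : SimpleGraph V} (D : PlaneEmbedding G)

theorem exists_point_of_mem_of_mem {u v u' v' : V} (h : G.Adj u v) (h' : G.Adj u' v')
    (hne : s(u, v) ≠ s(u', v')) {z : Plane} (hz : z ∈ D.curve s(u, v))
    (hz' : z ∈ D.curve s(u', v')) :
    ∃ w, z = D.point w ∧ (w = u ∨ w = v) ∧ (w = u' ∨ w = v') := by
  obtain ⟨w, ⟨h1, h2⟩, h3⟩ := D.inter_subset _ h _ h' hne ⟨hz, hz'⟩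
  exact ⟨w, h3.symm, Sym2.mem_iff.1 h1, Sym2.mem_iff.1 h2⟩

/-- A path of the graph is drawn as a simple arc. -/
theorem exists_isSimpleArc_of_isChain (l : List V) : ∀ (a b : V), List.IsChain G.Adj (a :: l ++ [b]) →
    (a :: l ++ [b]).Nodup → ∃ (n : ℕ) (p : ℕ → ℂ), IsSimpleArc p n ∧
      p 0 = planeEquiv (D.point a) ∧ p n = planeEquiv (D.point b) ∧
      ∀ z ∈ polyImage p n, ∃ u v, G.Adj u v ∧ u ∈ a :: l ++ [b] ∧ v ∈ a :: l ++ [b] ∧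
        planeEquiv.symm z ∈ D.curve s(u, v) := by
  induction l with
  | nil =>
    intro a b hc _
    have hab : G.Adj a b := by simpa using hc
    obtain ⟨n, p, h1, h2, h3, h4⟩ := (D.isPolygonalArc a b hab).exists_isSimpleArc
    exact ⟨n, p, h1, h2, h3, fun z hz => ⟨a, b, hab, by simp, by simp, h4 z hz⟩⟩
  | cons c l ih =>
    intro a b hc hnd
    simp only [List.cons_append, List.isChain_cons_cons] at hc
    have hnd' := List.nodup_cons.1 hnd
    obtain ⟨n, q, h1, h2, h3, h4⟩ := ih c b (by simpa using hc.2) hnd'.2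
    obtain ⟨m, p, g1, g2, g3, g4⟩ := (D.isPolygonalArc a c hc.1).exists_isSimpleArc
    have hj : p m = q 0 := by rw [g3, h2]
    refine ⟨m + n, polyConcat p m q, g1.concat h1 hj ?_, ?_, ?_, ?_⟩
    · intro z hz1 hz2
      obtain ⟨u, v, huv, hu, hv, hz3⟩ := h4 z hz2
      have ha : ∀ w ∈ c :: l ++ [b], w ≠ a := fun w hw hwa => hnd'.1 (hwa ▸ hw)
      obtain ⟨w, hw1, hw2, hw3⟩ := D.exists_point_of_mem_of_mem hc.1 huv (by
        intro he
        rcases Sym2.eq_iff.1 he with h | h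
        · exact ha u hu h.1.symm
        · exact ha v hv h.1.symm) (g4 z hz1) hz3
      rw [h2, ← (show w = c from ?_), ← hw1]
      · simp
      · rcases hw2 with rfl | h
        · rcases hw3 with h | h
          · exact absurd h.symm (ha u hu)
          · exact absurd h.symm (ha v hv)
        · exact h
    · rw [polyConcat_left hj (by omega), g2]
    · rw [polyConcat_right, h3]
    · intro z hz
      rw [polyImage_concat hj] at hz
      rcases hz with hz | hz
      · exact ⟨a, c, hc.1, by simp, by simp, g4 z hz⟩
      · obtain ⟨u, v, huv, hu, hv, hz3⟩ := h4 z hz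
        exact ⟨u, v, huv, List.mem_cons_of_mem _ hu, List.mem_cons_of_mem _ hv, hz3⟩

/-- A path of length at least two is drawn as a simple arc with an inner vertex as a bend. -/
theorem exists_isSimpleArc_bend {x y w : V} {l : List V}
    (hc : List.IsChain G.Adj (x :: (w :: l) ++ [y])) (hnd : (x :: (w :: l) ++ [y]).Nodup) :
    ∃ (n : ℕ) (p : ℕ → ℂ) (k : ℕ), IsSimpleArc p n ∧
      p 0 = planeEquiv (D.point x) ∧ p n = planeEquiv (D.point y) ∧ k + 1 < n ∧
      p (k + 1) = planeEquiv (D.point w) ∧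
      ∀ z ∈ polyImage p n, ∃ u v, G.Adj u v ∧ u ∈ w :: l ∧ v ∈ x :: (w :: l) ++ [y] ∧
        planeEquiv.symm z ∈ D.curve s(u, v) := by
  simp only [List.cons_append, List.isChain_cons_cons] at hc
  have hnd' := List.nodup_cons.1 hnd
  obtain ⟨n, q, h1, h2, h3, h4⟩ := D.exists_isSimpleArc_of_isChain l w y (by simpa using hc.2) hnd'.2
  obtain ⟨m, p, g1, g2, g3, g4⟩ := (D.isPolygonalArc x w hc.1).exists_isSimpleArc
  have hj : p m = q 0 := by rw [g3, h2]
  have hm := g1.pos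
  have hn := h1.pos
  -- The arc of the edge `x w` ends at corner `m`, an inner corner of the whole arc; hence `k + 1 =
  -- m`.
  refine ⟨m + n, polyConcat p m q, m - 1, g1.concat h1 hj ?_, ?_, ?_, by omega, ?_, ?_⟩
  · intro z hz1 hz2
    obtain ⟨u, v, huv, hu, hv, hz3⟩ := h4 z hz2
    have ha : ∀ u ∈ w :: l ++ [y], u ≠ x := fun u hu hwa => hnd'.1 (hwa ▸ hu)
    obtain ⟨t, hw1, hw2, hw3⟩ := D.exists_point_of_mem_of_mem hc.1 huv (by
      intro he
      rcases Sym2.eq_iff.1 he with h | h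
      · exact ha u hu h.1.symm
      · exact ha v hv h.1.symm) (g4 z hz1) hz3
    rw [h2, ← (show t = w from ?_), ← hw1]
    · simp
    · rcases hw2 with rfl | h
      · rcases hw3 with h | h
        · exact absurd h.symm (ha u hu)
        · exact absurd h.symm (ha v hv)
      · exact h
  · rw [polyConcat_left hj (by omega), g2]
  · rw [polyConcat_right, h3]
  · rw [Nat.sub_add_cancel hm, polyConcat_left hj le_rfl, g3]
  · intro z hz
    rw [polyImage_concat hj] at hz
    rcases hz with hz | hz
    · refine ⟨w, x, hc.1.symm, by simp, by simp, ?_⟩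
      rw [Sym2.eq_swap]
      exact g4 z hz
    · obtain ⟨u, v, huv, hu, hv, hz3⟩ := h4 z hz
      -- The edge is listed with an end inside the path first; this later separates edges of
      -- disjoint paths.
      by_cases huy : u = y
      · refine ⟨v, u, huv.symm, ?_, List.mem_cons_of_mem _ hu, by rwa [Sym2.eq_swap]⟩
        have hvy : v ≠ y := by rintro rfl; exact huv.ne huy
        simpa [hvy] using hv
      · exact ⟨u, v, huv, by simpa [huy] using hu, List.mem_cons_of_mem _ hv, hz3⟩

theorem polyAngle_eq_zero_of_mem_outerFace {r : ℕ → ℂ} {N : ℕ} (hN : 0 < N) (hcl : r N = r 0)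
    (hsub : ∀ z ∈ polyImage r N, planeEquiv.symm z ∈ D.image) {z : Plane} (hz : z ∈ D.outerFace) :
    polyAngle r N (planeEquiv z) = 0 := by
  set U := planeEquiv '' connectedComponentIn D.imageᶜ z
  refine polyAngle_eq_zero hN hcl (U := U)
    (isPreconnected_connectedComponentIn.image _ planeEquiv.continuous.continuousOn) ?_ ?_ ?_
  · intro hb
    apply hz.2
    have := planeEquiv.symm.lipschitz.isBounded_image hb
    rwa [← Set.image_comp, show (planeEquiv.symm : ℂ → Plane) ∘ planeEquiv = id by
      ext1 x; simp, Set.image_id] at this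
  · rintro q ⟨w, hw, rfl⟩ j hj hq
    have h1 := connectedComponentIn_subset _ _ hw
    apply h1
    have := hsub _ ⟨j, hj, hq⟩
    simpa using this
  · exact ⟨z, mem_connectedComponentIn hz.1, rfl⟩

end PlaneEmbedding

/-- Each path of a theta is drawn as an arc with an inner vertex as a bend. These vertices lie in
the closure of the outer face, where all winding numbers of polylines in the drawing vanish, so
`false_of_three_arcs` applies. -/
theorem IsOuterplanar.thetaFree {V : Type*} {G : SimpleGraph V} (h : IsOuterplanar G) :
    ThetaFree G := by
  obtain ⟨D, hD⟩ := h
  intro x y l₁ l₂ l₃ h₁ h₂ h₃ c₁ c₂ c₃ hnd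
  set l : Fin 3 → List V := ![l₁, l₂, l₃] with hl
  have hne : ∀ i, l i ≠ [] := by
    intro i; fin_cases i <;> assumption
  have hchain : ∀ i, List.IsChain G.Adj (x :: l i ++ [y]) := by
    intro i; fin_cases i <;> assumption
  have hx : ∀ i, x ∉ l i := by
    intro i; fin_cases i <;> simp [hl] <;> simp at hnd <;> tauto
  have hy : ∀ i, y ∉ l i := by
    intro i; fin_cases i <;> simp [hl] <;> simp at hnd <;> tauto
  have hxy : x ≠ y := by
    rintro rfl; simp at hnd
  have hlnd : ∀ i, (l i).Nodup := by
    simp only [List.nodup_cons, List.nodup_append] at hnd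
    intro i; fin_cases i <;> simp [hl] <;> tauto
  have hdisj : ∀ i j, i ≠ j → ∀ u ∈ l i, u ∉ l j := by
    simp only [List.nodup_cons, List.nodup_append, List.mem_append] at hnd
    have h12 : ∀ a ∈ l₁, ∀ b ∈ l₂, a ≠ b := by tauto
    have h3 : ∀ a, a ∈ l₁ ∨ a ∈ l₂ → ∀ b ∈ l₃, a ≠ b := hnd.2.2.2.2
    intro i j hij u hu hu'
    fin_cases i <;> fin_cases j <;> simp [hl] at hij hu hu'
    · exact h12 u hu u hu' rfl
    · exact h3 u (Or.inl hu) u hu' rfl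
    · exact h12 u hu' u hu rfl
    · exact h3 u (Or.inr hu) u hu' rfl
    · exact h3 u (Or.inl hu') u hu rfl
    · exact h3 u (Or.inr hu') u hu rfl
  clear hl
  clear_value l
  have harc : ∀ i, ∃ (n : ℕ) (p : ℕ → ℂ) (k : ℕ) (w : V), IsSimpleArc p n ∧
      p 0 = planeEquiv (D.point x) ∧ p n = planeEquiv (D.point y) ∧ k + 1 < n ∧
      p (k + 1) = planeEquiv (D.point w) ∧
      ∀ z ∈ polyImage p n, ∃ u v, G.Adj u v ∧ u ∈ l i ∧ v ∈ x :: l i ++ [y] ∧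
        planeEquiv.symm z ∈ D.curve s(u, v) := by
    intro i
    obtain ⟨w, l', hw⟩ := List.exists_cons_of_ne_nil (hne i)
    have hc := hchain i
    have hn : (x :: l i ++ [y]).Nodup := by
      rw [List.cons_append, List.nodup_cons, List.nodup_append]
      refine ⟨by simp [hx i, hxy], hlnd i, by simp, ?_⟩
      simp only [List.mem_singleton]
      rintro a ha b rfl rfl
      exact hy i ha
    rw [hw] at hc hn
    obtain ⟨n, p, k, h⟩ := D.exists_isSimpleArc_bend hc hn
    rw [hw]
    exact ⟨n, p, k, w, h⟩
  choose n p k w hp h0 h1 hk hw him using harc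
  have himage : ∀ i, ∀ z ∈ polyImage (p i) (n i), planeEquiv.symm z ∈ D.image := by
    intro i z hz
    obtain ⟨u, v, huv, _, _, hz'⟩ := him i z hz
    exact Or.inr (Set.mem_biUnion (x := s(u, v)) huv hz')
  refine false_of_three_arcs hp h0 h1 ?_ (O := planeEquiv '' D.outerFace) ?_ ?_ hk ?_
  · intro i j hij z hz1 hz2
    obtain ⟨u, v, huv, hu, hv, hz⟩ := him i z hz1
    obtain ⟨u', v', huv', hu', hv', hz'⟩ := him j z hz2
    have hmem : ∀ t i, t ∈ x :: l i ++ [y] ↔ t = x ∨ t ∈ l i ∨ t = y := by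
      intro t i; simp
    obtain ⟨t, ht1, ht2, ht3⟩ := D.exists_point_of_mem_of_mem huv huv' (by
      intro he
      rcases Sym2.eq_iff.1 he with ⟨rfl, rfl⟩ | ⟨rfl, rfl⟩
      · exact hdisj i j hij _ hu hu'
      · rcases (hmem _ _).1 hv' with rfl | h | rfl
        · exact hx i hu
        · exact hdisj i j hij _ hu h
        · exact hy i hu) hz hz'
    have htz : z = planeEquiv (D.point t) := by rw [← ht1]; simp
    have hti : t = x ∨ t ∈ l i ∨ t = y := by
      rcases ht2 with rfl | rfl
      · exact Or.inr (Or.inl hu)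
      · exact (hmem _ _).1 hv
    have htj : t = x ∨ t ∈ l j ∨ t = y := by
      rcases ht3 with rfl | rfl
      · exact Or.inr (Or.inl hu')
      · exact (hmem _ _).1 hv'
    rcases hti with rfl | hti | rfl
    · exact Or.inl htz
    · rcases htj with rfl | htj | rfl
      · exact Or.inl htz
      · exact absurd htj (hdisj i j hij t hti)
      · exact Or.inr htz
    · exact Or.inr htz
  · rintro i z ⟨q, hq, rfl⟩ hz
    have := himage i _ hz
    rw [ContinuousLinearEquiv.symm_apply_apply] at this
    exact hq.1 this
  · rintro r N hN hr hsub z ⟨q, hq, rfl⟩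
    refine D.polyAngle_eq_zero_of_mem_outerFace hN hr (fun z hz => ?_) hq
    obtain ⟨i, hi⟩ := Set.mem_iUnion.1 (hsub hz)
    exact himage i z hi
  · intro i
    rw [hw]
    have := frontier_subset_closure (hD (w i))
    exact image_closure_subset_closure_image planeEquiv.continuous ⟨_, this, rfl⟩

/-! ### Minimal counterexamples and local reductions. -/

section Reductions

variable {V : Type*}

/-- The colouring `c` is proper on `S` with respect to the square of `G`. -/
def SqProperOn (G : SimpleGraph V) (S : Set V) (c : V → Fin 6) : Prop :=
  ∀ u ∈ S, ∀ v ∈ S, (graphSquare G).Adj u v → c u ≠ c v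

/-- The square of `G` has a proper colouring with six colours. -/
def SqColorable (G : SimpleGraph V) : Prop := ∃ c, SqProperOn G Set.univ c

/-- Greedy extension: five vertices block at most five of the six colours. -/
theorem SqProperOn.exists_insert [Finite V] {G : SimpleGraph V} {S : Set V} {c : V → Fin 6}
    (h : SqProperOn G S c) {v : V} (T : Set V) (hT : T.ncard ≤ 5)
    (hsub : ∀ u ∈ S, (graphSquare G).Adj v u → u ∈ T) : ∃ c', SqProperOn G (insert v S) c' := by
  classical
  obtain ⟨k, hk⟩ : ∃ k, k ∉ c '' T := by
    by_contra hc
    push Not at hc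
    have h1 : c '' T = Set.univ := Set.eq_univ_of_forall hc
    have h2 := Set.ncard_image_le (f := c) T.toFinite
    rw [h1, Set.ncard_univ, Nat.card_eq_fintype_card, Fintype.card_fin] at h2
    omega
  have hkT : ∀ u ∈ S, (graphSquare G).Adj v u → k ≠ c u := by
    rintro u hu hvu rfl
    exact hk ⟨u, hsub u hu hvu, rfl⟩
  refine ⟨Function.update c v k, ?_⟩
  intro u hu w hw huw
  by_cases h1 : u = v
  · subst h1
    have hne : w ≠ u := huw.ne'
    rw [Function.update_self, Function.update_of_ne hne]
    exact hkT w (hw.resolve_left hne) huw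
  · rw [Function.update_of_ne h1]
    by_cases h2 : w = v
    · subst h2
      rw [Function.update_self]
      exact (hkT u (hu.resolve_left h1) huw.symm).symm
    · rw [Function.update_of_ne h2]
      exact h u (hu.resolve_left h1) w (hw.resolve_left h2) huw

/-- A minimal graph of maximum degree at most four without thetas whose square is not
`6`-colourable. -/
structure IsMinimalBad (G : SimpleGraph V) : Prop where
  degree_le : ∀ v, (G.neighborSet v).ncard ≤ 4
  thetaFree : ThetaFree G
  colorable_of_lt : ∀ G' < G, SqColorable G'
  not_colorable : ¬ SqColorable G

/-- The graph obtained from `G` by deleting all edges at vertices of `R`. -/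
def isolate (G : SimpleGraph V) (R : Set V) : SimpleGraph V where
  Adj u v := G.Adj u v ∧ u ∉ R ∧ v ∉ R
  symm := ⟨fun _ _ h => ⟨h.1.symm, h.2.2, h.2.1⟩⟩
  loopless := ⟨fun _ h => h.1.ne rfl⟩

/-- Isolating `R` loses only paths of length two through `R`, and by `hR` their ends outside `R` are
adjacent anyway. The edge `r s` makes the new graph strictly smaller. -/
theorem IsMinimalBad.exists_sqProperOn_compl {G : SimpleGraph V} (h : IsMinimalBad G) (R : Set V)
    {r s : V} (hr : r ∈ R) (hrs : G.Adj r s)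
    (hR : ∀ r ∈ R, ∀ u, u ∉ R → ∀ v, v ∉ R → G.Adj r u → G.Adj r v → u ≠ v → G.Adj u v) :
    ∃ c, SqProperOn G Rᶜ c := by
  have hlt : isolate G R < G := by
    refine lt_of_le_of_ne (fun u v huv => huv.1) fun he => ?_
    rw [← he] at hrs
    exact hrs.2.1 hr
  obtain ⟨c, hc⟩ := h.colorable_of_lt _ hlt
  refine ⟨c, fun u hu v hv huv => hc u trivial v trivial ⟨huv.1, ?_⟩⟩
  rcases huv.2 with h1 | ⟨w, h1, h2⟩
  · exact Or.inl ⟨h1, hu, hv⟩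
  · by_cases hw : w ∈ R
    · exact Or.inl ⟨hR w hw u hu v hv h1.symm h2 huv.1, hu, hv⟩
    · exact Or.inr ⟨w, ⟨h1, hu, hw⟩, ⟨h2, hw, hv⟩⟩

variable [Finite V]

theorem IsMinimalBad.false_of_simplicial {G : SimpleGraph V} (h : IsMinimalBad G) {v s : V}
    (hvs : G.Adj v s) (hcl : ∀ a b, G.Adj v a → G.Adj v b → a ≠ b → G.Adj a b) (T : Set V)
    (hT : T.ncard ≤ 5) (hsub : ∀ u, (graphSquare G).Adj v u → u ∈ T) : False := by
  obtain ⟨c, hc⟩ := h.exists_sqProperOn_compl {v} rfl hvs (by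
    rintro r rfl a _ b _ ha hb hab
    exact hcl a b ha hb hab)
  obtain ⟨c', hc'⟩ := hc.exists_insert T hT (fun u _ hu => hsub u hu)
  apply h.not_colorable
  refine ⟨c', ?_⟩
  convert hc' using 1
  ext x
  by_cases hx : x = v <;> simp [hx]

theorem IsMinimalBad.ncard_neighborSet_diff_le {G : SimpleGraph V} (h : IsMinimalBad G) {x v : V}
    (hxv : G.Adj x v) : (G.neighborSet x \ {v}).ncard ≤ 3 := by
  have := Set.ncard_sdiff_singleton_add_one (a := v) (s := G.neighborSet x) hxv
  have := h.degree_le x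
  omega

/-- If all neighbours of `v` and their other neighbours lie in the closed neighbourhood of a
neighbour `x` of `v`, and the neighbourhood of `v` is a clique, then `v` can be coloured last. -/
theorem IsMinimalBad.false_of_sq_subset {G : SimpleGraph V} (h : IsMinimalBad G) {v x : V}
    (hvx : G.Adj v x) (hcl : ∀ a b, G.Adj v a → G.Adj v b → a ≠ b → G.Adj a b)
    (hsub : ∀ u, (graphSquare G).Adj v u → u = x ∨ G.Adj x u) : False := by
  refine h.false_of_simplicial hvx hcl (insert x (G.neighborSet x \ {v})) ?_ ?_
  · have := Set.ncard_insert_le x (G.neighborSet x \ {v})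
    have := h.ncard_neighborSet_diff_le hvx.symm
    omega
  · intro u hu
    rcases hsub u hu with rfl | h1
    · exact Or.inl rfl
    · exact Or.inr ⟨h1, hu.ne'⟩

theorem IsMinimalBad.false_of_leaf {G : SimpleGraph V} (h : IsMinimalBad G) {v x : V}
    (hvx : G.Adj v x) (hN : ∀ u, G.Adj v u → u = x) : False := by
  refine h.false_of_sq_subset hvx ?_ ?_
  · intro a b ha hb hab
    exact absurd ((hN a ha).trans (hN b hb).symm) hab
  · rintro u ⟨h1, h2 | ⟨w, h2, h3⟩⟩
    · exact Or.inl (hN u h2)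
    · rw [hN w h2] at h3
      exact Or.inr h3

/-- The apex of a triangle with no other neighbours. -/
theorem IsMinimalBad.triangle_apex {G : SimpleGraph V} (h : IsMinimalBad G) {v x y : V}
    (hvx : G.Adj v x) (hvy : G.Adj v y) (hxy : G.Adj x y) (hN : ∀ u, G.Adj v u → u = x ∨ u = y) :
    (G.neighborSet x).ncard = 4 ∧ (G.neighborSet y).ncard = 4 ∧
      ∀ u, G.Adj x u → G.Adj y u → u = v := by
  -- This set contains all square neighbours of `v`. It has at most 4 + 4 - 1 - 1 = 6 elements, so
  -- exceeding 5 forces equality throughout.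
  have key : ¬ (((G.neighborSet x ∪ G.neighborSet y) \ {v}).ncard ≤ 5) := by
    intro hle
    refine h.false_of_simplicial hvx ?_ _ hle ?_
    · intro a b ha hb hab
      rcases hN a ha with rfl | rfl <;> rcases hN b hb with rfl | rfl
      · exact absurd rfl hab
      · exact hxy
      · exact hxy.symm
      · exact absurd rfl hab
    · rintro u ⟨h1, h2 | ⟨w, h2, h3⟩⟩
      · rcases hN u h2 with rfl | rfl
        · exact ⟨Or.inr hxy.symm, h1.symm⟩
        · exact ⟨Or.inl hxy, h1.symm⟩
      · rcases hN w h2 with rfl | rfl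
        · exact ⟨Or.inl h3, h1.symm⟩
        · exact ⟨Or.inr h3, h1.symm⟩
  have e1 := Set.ncard_sdiff_singleton_add_one (a := v) (s := G.neighborSet x ∪ G.neighborSet y)
    (Or.inl hvx.symm)
  have e2 := Set.ncard_union_add_ncard_inter (G.neighborSet x) (G.neighborSet y)
  have dx := h.degree_le x
  have dy := h.degree_le y
  have hv : v ∈ G.neighborSet x ∩ G.neighborSet y := ⟨hvx.symm, hvy.symm⟩
  have e3 : 1 ≤ (G.neighborSet x ∩ G.neighborSet y).ncard := by
    exact (Set.ncard_pos).2 ⟨v, hv⟩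
  refine ⟨by omega, by omega, fun u hu1 hu2 => ?_⟩
  by_contra hne
  have : 1 < (G.neighborSet x ∩ G.neighborSet y).ncard :=
    (Set.one_lt_ncard_iff).2 ⟨u, v, ⟨hu1, hu2⟩, hv, hne⟩
  omega

/-- Two adjacent vertices of degree two. -/
theorem IsMinimalBad.false_of_pair {G : SimpleGraph V} (h : IsMinimalBad G) {x v w z : V}
    (hxv : G.Adj x v) (hvw : G.Adj v w) (hwz : G.Adj w z) (hxw : x ≠ w) (hzv : z ≠ v) (hxz : x ≠ z)
    (hv : ∀ u, G.Adj v u → u = x ∨ u = w) (hw : ∀ u, G.Adj w u → u = v ∨ u = z)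
    (hz : G.Adj x z ∨ ∃ t, ∀ u, G.Adj z u → u = w ∨ u = t) : False := by
  obtain ⟨c, hc⟩ := h.exists_sqProperOn_compl {v, w} (Or.inl rfl) hvw (by
    rintro r (rfl | rfl) a ha b hb hra hrb hab
    · simp only [Set.mem_insert_iff, Set.mem_singleton_iff, not_or] at ha hb
      exact absurd (((hv a hra).resolve_right ha.2).trans ((hv b hrb).resolve_right hb.2).symm) hab
    · simp only [Set.mem_insert_iff, Set.mem_singleton_iff, not_or] at ha hb
      exact absurd (((hw a hra).resolve_left ha.1).trans ((hw b hrb).resolve_left hb.1).symm) hab)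
  -- While `w` is uncoloured, `v` sees `x`, `z` and at most three other neighbours of `x`.
  obtain ⟨c, hc⟩ := hc.exists_insert (v := v) (insert x (insert z (G.neighborSet x \ {v}))) (by
      have := h.ncard_neighborSet_diff_le hxv
      have := Set.ncard_insert_le z (G.neighborSet x \ {v})
      have := Set.ncard_insert_le x (insert z (G.neighborSet x \ {v}))
      omega) (by
    rintro u hu ⟨h1, h2 | ⟨t, h2, h3⟩⟩
    · simp only [Set.mem_compl_iff, Set.mem_insert_iff, Set.mem_singleton_iff, not_or] at hu
      exact Or.inl ((hv u h2).resolve_right hu.2)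
    · rcases hv t h2 with rfl | rfl
      · exact Or.inr (Or.inr ⟨h3, h1.symm⟩)
      · exact Or.inr (Or.inl ((hw u h3).resolve_left h1.symm)))
  -- Now `w` sees `v`, `z`, `x` and the other neighbours of `z`: there are at most three of these,
  -- with `x` among them, or else at most one.
  obtain ⟨c, hc⟩ := hc.exists_insert (v := w) (insert v (insert z (insert x (G.neighborSet z \ {w}))))
    (by
      have a1 := Set.ncard_insert_le v (insert z (insert x (G.neighborSet z \ {w})))
      have a2 := Set.ncard_insert_le z (insert x (G.neighborSet z \ {w}))
      rcases hz with hz | ⟨t, ht⟩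
      · rw [Set.insert_eq_of_mem (show x ∈ G.neighborSet z \ {w} from ⟨hz.symm, hxw⟩)] at *
        have := h.ncard_neighborSet_diff_le hwz.symm
        omega
      · have a3 := Set.ncard_insert_le x (G.neighborSet z \ {w})
        have : (G.neighborSet z \ {w}).ncard ≤ ({t} : Set V).ncard :=
          Set.ncard_le_ncard (fun u hu => (ht u hu.1).resolve_left hu.2)
        rw [Set.ncard_singleton] at this
        omega) (by
    rintro u hu ⟨h1, h2 | ⟨t, h2, h3⟩⟩
    · rcases hw u h2 with rfl | rfl
      · exact Or.inl rfl
      · exact Or.inr (Or.inl rfl)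
    · rcases hw t h2 with rfl | rfl
      · exact Or.inr (Or.inr (Or.inl ((hv u h3).resolve_right h1.symm)))
      · exact Or.inr (Or.inr (Or.inr ⟨h3, h1.symm⟩)))
  apply h.not_colorable
  refine ⟨c, ?_⟩
  convert hc using 1
  ext u
  simp
  tauto

end Reductions

/-! ### Explicit colourings of fans. -/

/-- `a 0, …, a m` is a square colouring with the colours `0, 1, 2, 3` of a path, with prescribed
colours at the ends. -/
def IsPathColoring (z : Fin 6) (m : ℕ) (a : ℕ → Fin 6) : Prop :=
  a 0 = 0 ∧ a 1 = 3 ∧ a m = 1 ∧ a (m - 1) = z ∧ (∀ k < m + 1, a k < 4) ∧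
    (∀ k < m, a k ≠ a (k + 1)) ∧ ∀ k < m - 1, a k ≠ a (k + 2)

instance (z : Fin 6) (m : ℕ) (a : ℕ → Fin 6) : Decidable (IsPathColoring z m a) := by
  unfold IsPathColoring; infer_instance

/-- Every such colouring starts with 0, 3, so 0, 3, 1 can be put in front of it. This lengthens the
path by three, and three base cases suffice. -/
theorem exists_isPathColoring {z : Fin 6} (hz : z = 2 ∨ z = 3) :
    ∀ m, 5 ≤ m → ∃ a, IsPathColoring z m a := by
  intro m
  induction m using Nat.strong_induction_on with
  | _ m ih =>
    intro hm
    rcases Nat.lt_or_ge m 8 with h8 | h8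
    · obtain rfl | rfl | rfl : m = 5 ∨ m = 6 ∨ m = 7 := by omega
      · rcases hz with rfl | rfl
        · exact ⟨fun k => [0, 3, 1, 0, 2, 1].getD k 0, by decide⟩
        · exact ⟨fun k => [0, 3, 1, 2, 3, 1].getD k 0, by decide⟩
      · rcases hz with rfl | rfl
        · exact ⟨fun k => [0, 3, 1, 0, 3, 2, 1].getD k 0, by decide⟩
        · exact ⟨fun k => [0, 3, 1, 0, 2, 3, 1].getD k 0, by decide⟩
      · rcases hz with rfl | rfl
        · exact ⟨fun k => [0, 3, 2, 1, 0, 3, 2, 1].getD k 0, by decide⟩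
        · exact ⟨fun k => [0, 3, 2, 1, 0, 2, 3, 1].getD k 0, by decide⟩
    · obtain ⟨m, rfl⟩ : ∃ n, m = n + 3 := ⟨m - 3, by omega⟩
      obtain ⟨a, h0, h1, h2, h3, h4, h5, h6⟩ := ih m (by omega) (by omega)
      refine ⟨fun k => match k with | 0 => 0 | 1 => 3 | 2 => 1 | k + 3 => a k, rfl, rfl, h2, ?_,
        ?_, ?_, ?_⟩
      · obtain ⟨m, rfl⟩ : ∃ n, m = n + 1 := ⟨m - 1, by omega⟩
        exact h3
      · rintro (_ | _ | _ | k) hk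
        · exact (by decide : (0 : Fin 6) < 4)
        · exact (by decide : (3 : Fin 6) < 4)
        · exact (by decide : (1 : Fin 6) < 4)
        · exact h4 k (by omega)
      · rintro (_ | _ | _ | k) hk
        · exact (by decide : (0 : Fin 6) ≠ 3)
        · exact (by decide : (3 : Fin 6) ≠ 1)
        · change 1 ≠ a 0
          rw [h0]; decide
        · exact h5 k (by omega)
      · rintro (_ | _ | _ | k) hk
        · exact (by decide : (0 : Fin 6) ≠ 1)
        · change 3 ≠ a 0
          rw [h0]; decide
        · change 1 ≠ a 1
          rw [h1]; decide
        · exact h6 k (by omega)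

/-- Positions `k < l` on a cycle `0, 2, 4, …, 2m` with triangles `k, k + 1, k + 2` attached to all
edges but the edge from `2m` to `0` that are adjacent in the square. -/
def FanSqAdj (m k l : ℕ) : Prop :=
  l ≤ k + 3 ∨ (l = k + 4 ∧ k % 2 = 0) ∨ (l = 2 * m ∧ k ≤ 2) ∨ (k = 0 ∧ 2 * m ≤ l + 2)

instance (m k l : ℕ) : Decidable (FanSqAdj m k l) := by unfold FanSqAdj; infer_instance

/-- `b 0, …, b (2 * m)` is a square colouring of the fan positions that respects the colours `p`
and `q` of the outer neighbours of the two ends. -/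
def IsFanColoring (m : ℕ) (x y p q : Fin 6) (b : ℕ → Fin 6) : Prop :=
  b 0 = x ∧ b (2 * m) = y ∧ b 1 ≠ p ∧ b 2 ≠ p ∧ b (2 * m - 1) ≠ q ∧
    b (2 * m - 2) ≠ q ∧ ∀ l < 2 * m + 1, ∀ k < l, FanSqAdj m k l → b k ≠ b l

instance (m : ℕ) (x y p q : Fin 6) (b : ℕ → Fin 6) : Decidable (IsFanColoring m x y p q b) := by
  unfold IsFanColoring; infer_instance

/-- For `m ≥ 5` the cycle uses the colours 0 to 3 and the apices alternate between 4 and 5, so cycle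
and apices do not interfere. Consecutive apices are the only ones adjacent in the square. -/
theorem exists_isFanColoring_normalized {m : ℕ} (hm : 3 ≤ m) {q : Fin 6} (hq : q = 2 ∨ q = 3) :
    ∃ b, IsFanColoring m 0 1 2 q b := by
  rcases Nat.lt_or_ge m 5 with h5 | h5
  · obtain rfl | rfl : m = 3 ∨ m = 4 := by omega
    · rcases hq with rfl | rfl
      · exact ⟨fun k => [0, 3, 4, 2, 5, 3, 1].getD k 0, by decide⟩
      · exact ⟨fun k => [0, 4, 3, 5, 2, 4, 1].getD k 0, by decide⟩
    · rcases hq with rfl | rfl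
      · exact ⟨fun k => [0, 5, 3, 1, 2, 0, 4, 5, 1].getD k 0, by decide⟩
      · exact ⟨fun k => [0, 5, 3, 1, 4, 0, 2, 5, 1].getD k 0, by decide⟩
  -- The colour of position `2 * m - 2`, which must avoid `q`.
  · obtain ⟨z, hz, hzq⟩ : ∃ z : Fin 6, (z = 2 ∨ z = 3) ∧ z ≠ q := by
      rcases hq with rfl | rfl
      · exact ⟨3, by decide, by decide⟩
      · exact ⟨2, by decide, by decide⟩
    obtain ⟨a, h0, h1, h2, h3, h4, h6, h7⟩ := exists_isPathColoring hz m h5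
    set t : ℕ → Fin 6 := fun s => if s % 2 = 0 then 4 else 5 with ht
    have ht4 : ∀ s, 4 ≤ t s := by
      intro s; simp only [ht]; split_ifs <;> decide
    have hat : ∀ k < m + 1, ∀ s, a k ≠ t s := fun k hk s he => by
      have := h4 k hk
      rw [he] at this
      exact absurd (ht4 s) (not_le.2 this)
    have htt : ∀ s, t s ≠ t (s + 1) := by
      intro s
      simp only [ht]
      rcases Nat.mod_two_eq_zero_or_one s with h | h
      · rw [if_pos h, if_neg (by omega)]; decide
      · rw [if_neg (by omega), if_pos (by omega)]; decide
    have hz0 : z ≠ 0 := by rcases hz with rfl | rfl <;> decide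
    have htq : ∀ s, t s ≠ q := by
      intro s; simp only [ht]; rcases hq with rfl | rfl <;> split_ifs <;> decide
    refine ⟨fun k => if k % 2 = 0 then a (k / 2) else t (k / 2), ?_, ?_, ?_, ?_, ?_, ?_, ?_⟩
    · exact h0
    · simp [h2]
    · simp [ht]
    · simp [h1]
    · have : (2 * m - 1) % 2 = 1 := by omega
      simp only [this]
      exact htq _
    · have e1 : (2 * m - 2) % 2 = 0 := by omega
      have e2 : (2 * m - 2) / 2 = m - 1 := by omega
      simp only [e1, e2, h3]
      exact hzq
    · intro l hl k hkl hadj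
      simp only
      rcases Nat.even_or_odd' k with ⟨s, rfl | rfl⟩ <;> rcases Nat.even_or_odd' l with ⟨r, rfl | rfl⟩
      · rw [if_pos (by omega), if_pos (by omega), show 2 * s / 2 = s by omega,
          show 2 * r / 2 = r by omega]
        have : r = s + 1 ∨ r = s + 2 ∨ (r = m ∧ (s = 0 ∨ s = 1)) ∨ (s = 0 ∧ r = m - 1) := by
          unfold FanSqAdj at hadj; omega
        rcases this with rfl | rfl | ⟨rfl, rfl | rfl⟩ | ⟨rfl, rfl⟩
        · exact h6 s (by omega)
        · exact h7 s (by omega)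
        · rw [h0, h2]; decide
        · rw [h1, h2]; decide
        · rw [h0, h3]; exact hz0.symm
      · rw [if_pos (by omega), if_neg (by omega)]
        exact hat _ (by omega) _
      · rw [if_neg (by omega), if_pos (by omega)]
        exact (hat _ (by omega) _).symm
      · rw [if_neg (by omega), if_neg (by omega), show (2 * s + 1) / 2 = s by omega,
          show (2 * r + 1) / 2 = r by omega]
        have : r = s + 1 := by
          unfold FanSqAdj at hadj; omega
        subst this
        exact htt s

/-- Permuting the colours sends `x`, `y`, `p` to 0, 1, 2; then `q` is either `p` or a fourth colour,
which becomes 3. -/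
theorem exists_isFanColoring {m : ℕ} (hm : 3 ≤ m) {x y p q : Fin 6} (hxy : x ≠ y) (hpx : p ≠ x)
    (hpy : p ≠ y) (hqx : q ≠ x) (hqy : q ≠ y) : ∃ b, IsFanColoring m x y p q b := by
  obtain ⟨σ, q₀, hx, hy, hp, hq₀, hq⟩ : ∃ (σ : Equiv.Perm (Fin 6)) (q₀ : Fin 6),
      σ 0 = x ∧ σ 1 = y ∧ σ 2 = p ∧ (q₀ = 2 ∨ q₀ = 3) ∧ σ q₀ = q := by
    have key : ∀ e : Fin 6, e ≠ x → e ≠ y → e ≠ p →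
        ∃ σ : Equiv.Perm (Fin 6), σ 0 = x ∧ σ 1 = y ∧ σ 2 = p ∧ σ 3 = e := by
      intro e hex hey hep
      have i1 : Function.Injective (![0, 1, 2, 3] : Fin 4 → Fin 6) := by decide
      have i2 : Function.Injective (![x, y, p, e] : Fin 4 → Fin 6) := by
        intro i j hij
        fin_cases i <;> fin_cases j <;> simp at hij ⊢ <;> simp_all
      obtain ⟨σ, hσ⟩ := (Equiv.Perm.isMultiplyPretransitive (Fin 6) 4).exists_smul_eq
        (⟨_, i1⟩ : Fin 4 ↪ Fin 6) ⟨_, i2⟩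
      have h := fun i => DFunLike.congr_fun hσ i
      exact ⟨σ, h 0, h 1, h 2, h 3⟩
    by_cases hpq : q = p
    · obtain ⟨e, h1, h2, h3⟩ : ∃ e : Fin 6, e ≠ x ∧ e ≠ y ∧ e ≠ p := by
        have : ∃ e, e ∉ ({x, y, p} : Finset (Fin 6)) := by
          by_contra hc
          push Not at hc
          have h1 := Finset.card_le_card (fun e _ => hc e : Finset.univ ⊆ ({x, y, p} : Finset (Fin 6)))
          have h2 := Finset.card_le_three (a := x) (b := y) (c := p)
          rw [Finset.card_univ, Fintype.card_fin] at h1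
          omega
        simpa using this
      obtain ⟨σ, a1, a2, a3, a4⟩ := key e h1 h2 h3
      exact ⟨σ, 2, a1, a2, a3, Or.inl rfl, a3.trans hpq.symm⟩
    · obtain ⟨σ, a1, a2, a3, a4⟩ := key q hqx hqy hpq
      exact ⟨σ, 3, a1, a2, a3, Or.inr rfl, a4⟩
  obtain ⟨b, h0, h1, h2, h3, h4, h5, h6⟩ := exists_isFanColoring_normalized hm hq₀
  refine ⟨fun k => σ (b k), (congrArg σ h0).trans hx, (congrArg σ h1).trans hy, ?_, ?_, ?_, ?_, ?_⟩
  · rw [← hp]; exact σ.injective.ne h2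
  · rw [← hp]; exact σ.injective.ne h3
  · rw [← hq]; exact σ.injective.ne h4
  · rw [← hq]; exact σ.injective.ne h5
  · exact fun l hl k hkl hadj => σ.injective.ne (h6 l hl k hkl hadj)

/-! ### Reducing fans and blocks with non-crossing chords. -/

section Fans

variable {V : Type*} [Finite V]

/-- An end `x` of a fan already has three neighbours in it, so by the degree bound at most one
outside. If there is none, any colour other than those of `x` and `y` will do. -/
theorem IsMinimalBad.exists_outer_color {G : SimpleGraph V} (h : IsMinimalBad G) {S : Set V}
    {c : V → Fin 6} (hc : SqProperOn G S c) {x y a b : V} (hx : x ∈ S) (hy : y ∈ S)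
    (hxy : G.Adj x y) (hxa : G.Adj x a) (hxb : G.Adj x b) (hab : a ≠ b) (hay : a ≠ y) (hby : b ≠ y)
    (hS : ∀ u, G.Adj x u → u ≠ a → u ≠ b → u ∈ S) :
    ∃ p, p ≠ c x ∧ p ≠ c y ∧ ∀ u, G.Adj x u → u ≠ a → u ≠ b → u ≠ y → c u = p := by
  by_cases hu : ∃ u, G.Adj x u ∧ u ≠ a ∧ u ≠ b ∧ u ≠ y
  · obtain ⟨u, hxu, hua, hub, huy⟩ := hu
    have huS := hS u hxu hua hub
    refine ⟨c u, hc u huS x hx ⟨hxu.ne', Or.inl hxu.symm⟩,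
      hc u huS y hy ⟨huy, Or.inr ⟨x, hxu.symm, hxy⟩⟩, fun w hxw hwa hwb hwy => ?_⟩
    by_contra hne
    have hwu : w ≠ u := fun he => hne (by rw [he])
    have hsub : ({a, b, y, u, w} : Set V) ⊆ G.neighborSet x := by
      rintro z (rfl | rfl | rfl | rfl | rfl) <;> assumption
    have h1 := Set.ncard_le_ncard hsub
    have h2 := h.degree_le x
    have h3 : ({a, b, y, u, w} : Set V).ncard = 5 := by
      rw [Set.ncard_insert_of_notMem, Set.ncard_insert_of_notMem, Set.ncard_insert_of_notMem,
        Set.ncard_pair hwu.symm] <;> simp [*, Ne.symm, hua.symm, hub.symm, huy.symm, hwa.symm,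
          hwb.symm, hwy.symm]
    omega
  · push Not at hu
    have : ∃ e, e ∉ ({c x, c y} : Finset (Fin 6)) := by
      by_contra hc'
      push Not at hc'
      have h1 := Finset.card_le_card (fun e _ => hc' e : Finset.univ ⊆ ({c x, c y} : Finset (Fin 6)))
      have h2 := Finset.card_le_two (a := c x) (b := c y)
      rw [Finset.card_univ, Fintype.card_fin] at h1
      omega
    obtain ⟨e, he⟩ := this
    simp only [Finset.mem_insert, Finset.mem_singleton, not_or] at he
    exact ⟨e, he.1, he.2, fun u h1 h2 h3 h4 => absurd (hu u h1 h2 h3) h4⟩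

/-- A cycle `f 0, f 2, …, f (2 * m)` all of whose edges, except the one between `f 0` and
`f (2 * m)`, carry triangles with apices `f 1, f 3, …`. -/
theorem IsMinimalBad.false_of_fan {G : SimpleGraph V} (h : IsMinimalBad G) (f : ℕ → V) {m : ℕ}
    (hm : 3 ≤ m) (hinj : ∀ k ≤ 2 * m, ∀ l ≤ 2 * m, f k = f l → k = l)
    (hN : ∀ k, 0 < k → k < 2 * m → ∀ u, G.Adj (f k) u → ∃ l ≤ 2 * m, u = f l)
    (hadj : ∀ k l, k < l → l ≤ 2 * m → G.Adj (f k) (f l) →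
      l = k + 1 ∨ (l = k + 2 ∧ k % 2 = 0) ∨ (k = 0 ∧ l = 2 * m))
    (h0m : G.Adj (f 0) (f (2 * m))) (h01 : G.Adj (f 0) (f 1)) (h02 : G.Adj (f 0) (f 2))
    (hm1 : G.Adj (f (2 * m)) (f (2 * m - 1))) (hm2 : G.Adj (f (2 * m)) (f (2 * m - 2))) : False := by
  classical
  have hadj' : ∀ k l, k ≤ 2 * m → l ≤ 2 * m → G.Adj (f k) (f l) →
      l = k + 1 ∨ (l = k + 2 ∧ k % 2 = 0) ∨ (k = 0 ∧ l = 2 * m) ∨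
      k = l + 1 ∨ (k = l + 2 ∧ l % 2 = 0) ∨ (l = 0 ∧ k = 2 * m) := by
    intro k l hk hl hkl
    rcases lt_trichotomy k l with h1 | h1 | h1
    · have := hadj k l h1 hl hkl; tauto
    · subst h1; exact absurd rfl hkl.ne
    · have := hadj l k h1 hk hkl.symm; tauto
  set R : Set V := {v | ∃ k, 0 < k ∧ k < 2 * m ∧ v = f k} with hR
  have hend : ∀ l, l ≤ 2 * m → f l ∉ R → l = 0 ∨ l = 2 * m := by
    intro l hl hlR
    by_contra hc
    exact hlR ⟨l, by omega, by omega, rfl⟩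
  have hnot : ∀ l, l ≤ 2 * m → (l = 0 ∨ l = 2 * m) → f l ∉ R := by
    rintro l hl h1 ⟨k, h2, h3, h4⟩
    have := hinj _ hl _ h3.le h4
    omega
  have h0R := hnot 0 (by omega) (Or.inl rfl)
  have hmR := hnot (2 * m) le_rfl (Or.inr rfl)
  obtain ⟨c, hc⟩ := h.exists_sqProperOn_compl R (r := f 1) (s := f 0)
    ⟨1, by omega, by omega, rfl⟩ h01.symm (by
      rintro r ⟨k, hk0, hkm, rfl⟩ u hu v hv hru hrv huv
      obtain ⟨a, ha, rfl⟩ := hN k hk0 hkm u hru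
      obtain ⟨b, hb, rfl⟩ := hN k hk0 hkm v hrv
      rcases hend a ha hu with rfl | rfl <;> rcases hend b hb hv with rfl | rfl
      · exact absurd rfl huv
      · exact h0m
      · exact h0m.symm
      · exact absurd rfl huv)
  have hne : ∀ k l, k ≤ 2 * m → l ≤ 2 * m → k ≠ l → f k ≠ f l :=
    fun k l hk hl hkl he => hkl (hinj k hk l hl he)
  obtain ⟨p, hp1, hp2, hp⟩ := h.exists_outer_color hc h0R hmR h0m h01 h02
    (hne _ _ (by omega) (by omega) (by omega)) (hne _ _ (by omega) (by omega) (by omega))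
    (hne _ _ (by omega) (by omega) (by omega)) (by
      rintro u hu h1 h2 ⟨k, hk0, hkm, rfl⟩
      have := hadj' 0 k (by omega) (by omega) hu
      obtain rfl | rfl : k = 1 ∨ k = 2 := by omega
      · exact h1 rfl
      · exact h2 rfl)
  obtain ⟨q, hq1, hq2, hq⟩ := h.exists_outer_color hc hmR h0R h0m.symm hm1 hm2
    (hne _ _ (by omega) (by omega) (by omega)) (hne _ _ (by omega) (by omega) (by omega))
    (hne _ _ (by omega) (by omega) (by omega)) (by
      rintro u hu h1 h2 ⟨k, hk0, hkm, rfl⟩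
      have := hadj' (2 * m) k (by omega) (by omega) hu
      obtain rfl | rfl : k = 2 * m - 1 ∨ k = 2 * m - 2 := by omega
      · exact h1 rfl
      · exact h2 rfl)
  obtain ⟨b, b0, bm, b1, b2, b3, b4, hb⟩ := exists_isFanColoring hm
    (hc _ h0R _ hmR ⟨h0m.ne, Or.inl h0m⟩) hp1 hp2 hq2 hq1
  set c' : V → Fin 6 := fun v => if hv : v ∈ R then b hv.choose else c v with hc'
  have c'_out : ∀ v, v ∉ R → c' v = c v := fun v hv => dif_neg hv
  have c'_f : ∀ k ≤ 2 * m, c' (f k) = b k := by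
    intro k hk
    by_cases hkR : f k ∈ R
    · have hs := hkR.choose_spec
      have := hinj _ hk _ hs.2.1.le hs.2.2
      simp only [hc', dif_pos hkR]
      rw [← this]
    · rw [c'_out _ hkR]
      rcases hend k hk hkR with rfl | rfl
      · exact b0.symm
      · exact bm.symm
  have key : ∀ u ∈ R, ∀ v, (graphSquare G).Adj u v → c' u ≠ c' v := by
    rintro _ ⟨k, hk0, hkm, rfl⟩ v ⟨huv, hsq⟩
    have hfan : ∀ l ≤ 2 * m, l ≠ k → (k < l → FanSqAdj m k l) → (l < k → FanSqAdj m l k) →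
        c' (f k) ≠ c' (f l) := by
      intro l hl hlk h1 h2
      rw [c'_f k hkm.le, c'_f l hl]
      rcases lt_or_gt_of_ne hlk with h3 | h3
      · exact (hb k (by omega) l h3 (h2 h3)).symm
      · exact hb l (by omega) k h3 (h1 h3)
    rcases hsq with h1 | ⟨w, h1, h2⟩
    · obtain ⟨l, hl, rfl⟩ := hN k hk0 hkm v h1
      have := hadj' k l hkm.le hl h1
      refine hfan l hl (fun he => huv (by rw [he])) ?_ ?_ <;> unfold FanSqAdj <;> omega
    · obtain ⟨i, hi, rfl⟩ := hN k hk0 hkm w h1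
      have e1 := hadj' k i hkm.le hi h1
      by_cases hv : ∃ l ≤ 2 * m, v = f l
      · obtain ⟨l, hl, rfl⟩ := hv
        have e2 := hadj' i l hi hl h2
        have hlk : l ≠ k := fun he => huv (by rw [he])
        refine hfan l hl hlk ?_ ?_ <;> unfold FanSqAdj <;> omega
      -- A vertex off the fan is reached only through one of its two ends, so its colour is `p` or
      -- `q`.
      · push Not at hv
        have hvR : v ∉ R := by
          rintro ⟨l, _, hl, hvl⟩
          exact hv l hl.le hvl
        rw [c'_out v hvR, c'_f k hkm.le]
        have hi' : i = 0 ∨ i = 2 * m := by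
          by_contra hcon
          obtain ⟨l, hl, hvl⟩ := hN i (by omega) (by omega) v h2
          exact hv l hl hvl
        rcases hi' with rfl | rfl
        · rw [hp v h2 (hv 1 (by omega)) (hv 2 (by omega)) (hv (2 * m) le_rfl)]
          obtain rfl | rfl : k = 1 ∨ k = 2 := by omega
          · exact b1
          · exact b2
        · rw [hq v h2 (hv _ (by omega)) (hv _ (by omega)) (hv 0 (by omega))]
          obtain rfl | rfl : k = 2 * m - 1 ∨ k = 2 * m - 2 := by omega
          · exact b3
          · exact b4
  apply h.not_colorable
  refine ⟨c', fun u _ v _ huv => ?_⟩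
  by_cases hu : u ∈ R
  · exact key u hu v huv
  · by_cases hv : v ∈ R
    · exact (key v hv u huv.symm).symm
    · rw [c'_out u hu, c'_out v hv]
      exact hc u hu v hv huv

/-- The vertices `f 0, …, f d` form a cycle whose chords have length at most two. -/
theorem IsMinimalBad.false_of_short_chords {G : SimpleGraph V} (h : IsMinimalBad G) (f : ℕ → V)
    {d : ℕ} (hd : 3 ≤ d) (hinj : ∀ k ≤ d, ∀ l ≤ d, f k = f l → k = l)
    (hpath : ∀ k < d, G.Adj (f k) (f (k + 1))) (h0d : G.Adj (f 0) (f d))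
    (hN : ∀ k, 0 < k → k < d → ∀ u, G.Adj (f k) u → ∃ l ≤ d, u = f l)
    (hshort : ∀ k l, k < l → l ≤ d → G.Adj (f k) (f l) → l ≤ k + 2 ∨ (k = 0 ∧ l = d))
    (hcross : ∀ k, k + 3 ≤ d → G.Adj (f k) (f (k + 2)) → ¬ G.Adj (f (k + 1)) (f (k + 3))) :
    False := by
  have hne : ∀ k l, k ≤ d → l ≤ d → k ≠ l → f k ≠ f l :=
    fun k l hk hl hkl he => hkl (hinj k hk l hl he)
  -- neighbours of inner vertices
  have hnb : ∀ k, 0 < k → k < d → ∀ u, G.Adj (f k) u →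
      u = f (k - 1) ∨ u = f (k + 1) ∨
        (2 ≤ k ∧ u = f (k - 2) ∧ G.Adj (f (k - 2)) (f k)) ∨
        (k + 2 ≤ d ∧ u = f (k + 2) ∧ G.Adj (f k) (f (k + 2))) := by
    intro k hk0 hkd u hu
    obtain ⟨l, hl, rfl⟩ := hN k hk0 hkd u hu
    rcases lt_trichotomy k l with h1 | h1 | h1
    · have := hshort k l h1 hl hu
      obtain rfl | rfl : l = k + 1 ∨ l = k + 2 := by omega
      · exact Or.inr (Or.inl rfl)
      · exact Or.inr (Or.inr (Or.inr ⟨hl, rfl, hu⟩))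
    · subst h1; exact absurd rfl hu.ne
    · have := hshort l k h1 hkd.le hu.symm
      obtain rfl | rfl : k = l + 1 ∨ k = l + 2 := by omega
      · exact Or.inl rfl
      · exact Or.inr (Or.inr (Or.inl ⟨by omega, rfl, hu.symm⟩))
  by_cases hT : ∃ k, k + 2 ≤ d ∧ G.Adj (f k) (f (k + 2))
  -- The vertex under a chord of length two has degree two, as no chord crosses it.
  · have hapex : ∀ k, k + 2 ≤ d → G.Adj (f k) (f (k + 2)) →
        (G.neighborSet (f k)).ncard = 4 ∧ (G.neighborSet (f (k + 2))).ncard = 4 ∧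
          ∀ u, G.Adj (f k) u → G.Adj (f (k + 2)) u → u = f (k + 1) := by
      intro k hk hkk
      refine h.triangle_apex (hpath k (by omega)).symm (hpath (k + 1) (by omega)) hkk ?_
      intro u hu
      rcases hnb (k + 1) (by omega) (by omega) u hu with h1 | h1 | ⟨h1, _, h3⟩ | ⟨h1, _, h3⟩
      · exact Or.inl h1
      · exact Or.inr h1
      · obtain ⟨k, rfl⟩ : ∃ j, k = j + 1 := ⟨k - 1, by omega⟩
        exact absurd hkk (hcross k hk h3)
      · exact absurd h3 (hcross k h1 hkk)
    have hcard3 : ∀ a b c : V, ∀ x, (∀ u, G.Adj x u → u = a ∨ u = b ∨ u = c) →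
        (G.neighborSet x).ncard ≠ 4 := by
      intro a b c x hx h4
      have h1 : (G.neighborSet x).ncard ≤ ({a, b, c} : Set V).ncard := Set.ncard_le_ncard hx
      have h2 := Set.ncard_insert_le a {b, c}
      have h3 := Set.ncard_insert_le b {c}
      rw [Set.ncard_singleton] at h3
      omega
    -- An inner end of a triangle has degree four, which requires another chord of length two on its
    -- far side. Thus triangles spread in both directions up to the ends `f 0` and `f d`.
    have hup : ∀ k, k + 2 < d → G.Adj (f k) (f (k + 2)) →
        k + 4 ≤ d ∧ G.Adj (f (k + 2)) (f (k + 4)) := by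
      intro k hk hkk
      by_contra hcon
      refine hcard3 (f (k + 1)) (f (k + 3)) (f k) (f (k + 2)) (fun u hu => ?_)
        (hapex k hk.le hkk).2.1
      rcases hnb (k + 2) (by omega) hk u hu with h1 | h1 | ⟨_, h2, _⟩ | ⟨h1, _, h3⟩
      · exact Or.inl h1
      · exact Or.inr (Or.inl h1)
      · exact Or.inr (Or.inr h2)
      · exact absurd ⟨h1, h3⟩ hcon
    have hdown : ∀ k, 0 < k → k + 2 ≤ d → G.Adj (f k) (f (k + 2)) →
        2 ≤ k ∧ G.Adj (f (k - 2)) (f k) := by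
      intro k hk0 hk hkk
      by_contra hcon
      refine hcard3 (f (k - 1)) (f (k + 1)) (f (k + 2)) (f k) (fun u hu => ?_) (hapex k hk hkk).1
      rcases hnb k hk0 (by omega) u hu with h1 | h1 | ⟨h1, _, h3⟩ | ⟨_, h2, _⟩
      · exact Or.inl h1
      · exact Or.inr (Or.inl h1)
      · exact absurd ⟨h1, h3⟩ hcon
      · exact Or.inr (Or.inr h2)
    have hT0 : G.Adj (f 0) (f 2) := by
      obtain ⟨k, hk, hkk⟩ := hT
      induction k using Nat.strong_induction_on with
      | _ k ih =>
        rcases Nat.eq_zero_or_pos k with rfl | hpos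
        · exact hkk
        · obtain ⟨h1, h2⟩ := hdown k hpos hk hkk
          obtain ⟨k, rfl⟩ : ∃ j, k = j + 2 := ⟨k - 2, by omega⟩
          exact ih k (by omega) (by omega) h2
    have hTs : ∀ s, 2 * s < d → 2 * s + 2 ≤ d ∧ G.Adj (f (2 * s)) (f (2 * s + 2)) := by
      intro s
      induction s with
      | zero => intro _; exact ⟨by omega, hT0⟩
      | succ s ih =>
        intro hs
        obtain ⟨h1, h2⟩ := ih (by omega)
        exact hup (2 * s) (by omega) h2
    obtain ⟨m, rfl⟩ : ∃ m, d = 2 * m := by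
      rcases Nat.even_or_odd' d with ⟨m, rfl | rfl⟩
      · exact ⟨m, rfl⟩
      · have := (hTs m (by omega)).1
        omega
    have hlast : G.Adj (f (2 * m - 2)) (f (2 * m)) := by
      have := (hTs (m - 1) (by omega)).2
      rwa [show 2 * (m - 1) = 2 * m - 2 by omega, show 2 * m - 2 + 2 = 2 * m by omega] at this
    rcases Nat.lt_or_ge m 3 with hm | hm
    -- Two triangles only: `f 0` and `f 2` have the second common neighbour `f 4`, which
    -- `triangle_apex` forbids.
    · obtain rfl : m = 2 := by omega
      have := (hapex 0 (by omega) hT0).2.2 (f 4) h0d hlast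
      exact hne 4 1 (by omega) (by omega) (by omega) this
    · refine h.false_of_fan f hm hinj hN ?_ h0d (hpath 0 (by omega)) hT0 ?_ hlast.symm
      · intro k l hkl hl hadj
        rcases hshort k l hkl hl hadj with h1 | h1
        · obtain rfl | rfl : l = k + 1 ∨ l = k + 2 := by omega
          · exact Or.inl rfl
          · refine Or.inr (Or.inl ⟨rfl, ?_⟩)
            by_contra hodd
            obtain ⟨s, rfl⟩ : ∃ s, k = 2 * s + 1 := ⟨k / 2, by omega⟩
            exact hcross (2 * s) hl (hTs s (by omega)).2 hadj
        · exact Or.inr (Or.inr h1)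
      · have := hpath (2 * m - 1) (by omega)
        rw [Nat.sub_add_cancel (by omega)] at this
        exact this.symm
  · push Not at hT
    have hnb' : ∀ k, 0 < k → k < d → ∀ u, G.Adj (f k) u → u = f (k - 1) ∨ u = f (k + 1) := by
      intro k hk0 hkd u hu
      rcases hnb k hk0 hkd u hu with h1 | h1 | ⟨h1, _, h3⟩ | ⟨h1, _, h3⟩
      · exact Or.inl h1
      · exact Or.inr h1
      · refine absurd ?_ (hT (k - 2) (by omega))
        rwa [Nat.sub_add_cancel h1]
      · exact absurd h3 (hT k h1)
    -- Without chords of length two, `f 1` and `f 2` have degree two. Either `d = 3` and `f 0`, `f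
    -- 3` are adjacent, or `f 3` has degree two as well.
    refine h.false_of_pair (hpath 0 (by omega)) (hpath 1 (by omega)) (hpath 2 (by omega))
      (hne _ _ (by omega) (by omega) (by omega)) (hne _ _ (by omega) (by omega) (by omega))
      (hne _ _ (by omega) (by omega) (by omega)) (hnb' 1 (by omega) (by omega))
      (hnb' 2 (by omega) (by omega)) ?_
    rcases Nat.eq_or_lt_of_le hd with rfl | h4
    · exact Or.inl h0d
    · exact Or.inr ⟨_, hnb' 3 (by omega) h4⟩

/-- A block drawn as a Hamiltonian cycle with non-crossing chords, all of whose vertices but `f 0`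
have no neighbours outside. -/
theorem IsMinimalBad.false_of_hamiltonian_block {G : SimpleGraph V} (h : IsMinimalBad G)
    (f : ℕ → V) {n : ℕ} (hn : 3 ≤ n) (hinj : ∀ k < n, ∀ l < n, f k = f l → k = l)
    (hpath : ∀ k, k + 1 < n → G.Adj (f k) (f (k + 1))) (hclose : G.Adj (f 0) (f (n - 1)))
    (hN : ∀ k, 0 < k → k < n → ∀ u, G.Adj (f k) u → ∃ l < n, u = f l)
    (hcross : ∀ i j k l, i < j → j < k → k < l → l < n →
      G.Adj (f i) (f k) → ¬ G.Adj (f j) (f l)) : False := by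
  classical
  rcases Nat.eq_or_lt_of_le hn with rfl | hn4
  · have hN1 : ∀ u, G.Adj (f 1) u → u = f 0 ∨ u = f 2 := by
      intro u hu
      obtain ⟨l, hl, rfl⟩ := hN 1 (by omega) (by omega) u hu
      interval_cases l
      · exact Or.inl rfl
      · exact absurd rfl hu.ne
      · exact Or.inr rfl
    refine h.false_of_sq_subset (hpath 0 (by omega)).symm ?_ ?_
    · intro a b ha hb hab
      rcases hN1 a ha with rfl | rfl <;> rcases hN1 b hb with rfl | rfl
      · exact absurd rfl hab
      · exact hclose
      · exact hclose.symm
      · exact absurd rfl hab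
    · rintro u ⟨h1, h2 | ⟨w, h2, h3⟩⟩
      · rcases hN1 u h2 with rfl | rfl
        · exact Or.inl rfl
        · exact Or.inr hclose
      · rcases hN1 w h2 with rfl | rfl
        · exact Or.inr h3
        · obtain ⟨l, hl, rfl⟩ := hN 2 (by omega) (by omega) u h3
          interval_cases l
          · exact Or.inl rfl
          · exact absurd rfl h1
          · exact absurd rfl h3.ne
  -- A shortest chord of length at least three; the closing edge is one of length `n - 1`. The
  -- vertex `f 0` is never strictly inside the part cut off.
  · have hex : ∃ d, 3 ≤ d ∧ ∃ i, i + d < n ∧ G.Adj (f i) (f (i + d)) :=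
      ⟨n - 1, by omega, 0, by omega, by rwa [Nat.zero_add]⟩
    obtain ⟨hd, i, hi, hadj⟩ := Nat.find_spec hex
    have hmin : ∀ d', d' < Nat.find hex → ¬ _ := fun d' hd' => Nat.find_min hex hd'
    generalize Nat.find hex = d at *
    refine h.false_of_short_chords (fun k => f (i + k)) hd ?_ ?_ hadj ?_ ?_ ?_
    · intro k hk l hl he
      have := hinj _ (by omega) _ (by omega) he
      omega
    · intro k hk
      exact hpath (i + k) (by omega)
    · intro k hk0 hkd u hu
      obtain ⟨l, hl, rfl⟩ := hN (i + k) (by omega) (by omega) u hu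
      by_cases h1 : l < i
      · exact absurd hadj (hcross l i (i + k) (i + d) h1 (by omega) (by omega) (by omega) hu.symm)
      · by_cases h2 : i + d < l
        · exact absurd hu (hcross i (i + k) (i + d) l (by omega) (by omega) (by omega) hl hadj)
        · exact ⟨l - i, by omega, by rw [Nat.add_sub_cancel' (by omega)]⟩
    · intro k l hkl hl hkl'
      by_contra hcon
      refine hmin (l - k) (by omega) ⟨by omega, i + k, by omega, ?_⟩
      rw [show i + k + (l - k) = i + l by omega]
      exact hkl'
    · intro k hk h1 h2
      exact hcross (i + k) (i + (k + 1)) (i + (k + 2)) (i + (k + 3)) (by omega) (by omega)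
        (by omega) (by omega) h1 h2

end Fans

/-! ### Circuits and crossing chords. -/

section Circuits

variable {V : Type*} {G : SimpleGraph V}

/-- The list `L` is the sequence of vertices of a cycle of `G`, or consists of the ends of an
edge. -/
def IsCircuit (G : SimpleGraph V) (L : List V) : Prop :=
  L.Nodup ∧ 2 ≤ L.length ∧ ∃ a t, L = a :: t ∧ List.IsChain G.Adj (a :: t ++ [a])

theorem IsCircuit.rotate {l₁ l₂ : List V} {b : V} (h : IsCircuit G (l₁ ++ b :: l₂)) :
    IsCircuit G (b :: l₂ ++ l₁) := by
  obtain ⟨h1, h2, a, t, h3, h4⟩ := h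
  refine ⟨(List.perm_append_comm.nodup_iff).1 h1, by simp at h2 ⊢; omega, b, l₂ ++ l₁, rfl, ?_⟩
  rw [← h3] at h4
  rcases l₁ with _ | ⟨c, l₁⟩
  · simp only [List.nil_append, List.cons.injEq] at h3 h4
    obtain ⟨rfl, rfl⟩ := h3
    simpa using h4
  · simp only [List.cons_append, List.cons.injEq] at h3
    obtain ⟨rfl, rfl⟩ := h3
    have h5 : List.IsChain G.Adj ((c :: l₁) ++ b :: (l₂ ++ [c])) := by simpa using h4
    rw [List.isChain_split] at h5
    have h6 : List.IsChain G.Adj ((b :: l₂) ++ c :: (l₁ ++ [b])) := by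
      rw [List.isChain_split]
      exact ⟨by simpa using h5.2, by simpa using h5.1⟩
    simpa using h6

theorem IsCircuit.isChain {a : V} {t : List V} (h : IsCircuit G (a :: t)) :
    List.IsChain G.Adj (a :: t ++ [a]) := by
  obtain ⟨_, _, b, s, h3, h4⟩ := h
  simp only [List.cons.injEq] at h3
  obtain ⟨rfl, rfl⟩ := h3
  exact h4

theorem isChain_reverse_of_isChain {l : List V} (h : List.IsChain G.Adj l) :
    List.IsChain G.Adj l.reverse := by
  rw [List.isChain_reverse]
  exact h.imp fun a b hab => hab.symm

/-- Crossing chords of a circuit leave no vertices between their ends. -/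
theorem IsCircuit.eq_nil_of_crossing (hG : ThetaFree G) {a b d e : V} {l₁ l₂ l₃ l₄ : List V}
    (h : IsCircuit G (a :: l₁ ++ b :: l₂ ++ d :: l₃ ++ e :: l₄)) (had : G.Adj a d)
    (hbe : G.Adj b e) : l₁ = [] := by
  by_contra hne
  have hnd := h.1
  have hc : List.IsChain G.Adj (a :: (l₁ ++ b :: l₂ ++ d :: l₃ ++ e :: l₄) ++ [a]) :=
    IsCircuit.isChain (by simpa using h)
  have c1 : List.IsChain G.Adj ((a :: l₁) ++ b :: (l₂ ++ d :: l₃ ++ e :: l₄ ++ [a])) := by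
    simpa using hc
  rw [List.isChain_split] at c1
  have c2 : List.IsChain G.Adj ((b :: l₂) ++ d :: (l₃ ++ e :: l₄ ++ [a])) := by simpa using c1.2
  rw [List.isChain_split] at c2
  have c3 : List.IsChain G.Adj ((d :: l₃) ++ e :: (l₄ ++ [a])) := by simpa using c2.2
  rw [List.isChain_split] at c3
  -- The theta between `a` and `b`: along `l₁`; over the chord to `d` and back along `l₂`; backwards
  -- along `l₄` to `e` and over the chord to `b`.
  refine hG a b l₁ (d :: l₂.reverse) (l₄.reverse ++ [e]) hne (by simp) (by simp) c1.1 ?_ ?_ ?_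
  · have := isChain_reverse_of_isChain c2.1
    simp only [List.reverse_append, List.reverse_cons, List.reverse_nil, List.nil_append,
      List.cons_append] at this
    simpa using List.isChain_cons_cons.2 ⟨had, this⟩
  · have h4 := isChain_reverse_of_isChain c3.2
    have h5 : List.IsChain G.Adj ((a :: l₄.reverse) ++ e :: [b]) := by
      rw [List.isChain_split]
      exact ⟨by simpa using h4, by simpa using hbe.symm⟩
    simpa using h5
  · refine (List.Perm.nodup_iff ?_).1 (List.Nodup.sublist ?_ hnd (l₁ := a :: l₁ ++ b :: l₂ ++ [d] ++ e :: l₄))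
    · classical
      rw [List.perm_iff_count]
      intro x
      simp [List.count_cons, List.count_append]
      omega
    · simp

theorem exists_isChain_of_reachable {H : SimpleGraph V} (hH : H ≤ G) {a w u z : V}
    (h : H.Reachable w u) (haw : G.Adj a w) (huz : G.Adj u z) : ∃ s : List V, s ≠ [] ∧ s.Nodup ∧
      (∀ x ∈ s, H.Reachable w x) ∧ List.IsChain G.Adj (a :: s ++ [z]) := by
  classical
  obtain ⟨p⟩ := h
  set q := (p.toPath : H.Walk w u) with hq
  have hqp : q.IsPath := p.toPath.2
  refine ⟨q.support, q.support_ne_nil, hqp.support_nodup,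
    fun x hx => ⟨q.takeUntil x hx⟩, ?_⟩
  have := (SimpleGraph.Walk.cons haw ((q.mapLe hH).concat huz)).isChain_adj_support
  simpa [SimpleGraph.Walk.support_concat] using this

end Circuits

/-! ### Minimal lumps and their Hamiltonian circuits. -/

section Lumps

variable {V : Type*} {G : SimpleGraph V}

/-- The vertices of `B` other than `c` are not isolated and have all their neighbours in `B`. -/
structure IsLump (G : SimpleGraph V) (B : Set V) (c : V) : Prop where
  mem : c ∈ B
  exists_ne : ∃ v ∈ B, v ≠ c
  closed : ∀ v ∈ B, v ≠ c → ∀ u, G.Adj v u → u ∈ B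
  exists_adj : ∀ v ∈ B, v ≠ c → ∃ u, G.Adj v u

/-- A lump with the minimal number of vertices. -/
structure IsMinimalLump (G : SimpleGraph V) (B : Set V) (c : V) : Prop extends IsLump G B c where
  le : ∀ B' c', IsLump G B' c' → B.ncard ≤ B'.ncard

/-- Some edge exists, since a constant colouring works for an edgeless graph. The set of all
non-isolated vertices is then a lump. -/
theorem IsMinimalBad.exists_isMinimalLump (h : IsMinimalBad G) : ∃ B c, IsMinimalLump G B c := by
  classical
  have hadj : ∃ u v, G.Adj u v := by
    by_contra hc
    push Not at hc
    apply h.not_colorable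
    refine ⟨fun _ => 0, ?_⟩
    rintro u _ v _ ⟨_, h1 | ⟨w, h1, _⟩⟩
    · exact absurd h1 (hc u v)
    · exact absurd h1 (hc u w)
  obtain ⟨u, v, huv⟩ := hadj
  have hex : ∃ n, ∃ B c, IsLump G B c ∧ B.ncard = n :=
    ⟨_, {v | ∃ u, G.Adj v u}, u, ⟨⟨v, huv⟩, ⟨v, ⟨u, huv.symm⟩, huv.ne'⟩,
      fun v _ _ u hu => ⟨v, hu.symm⟩, fun v hv _ => hv⟩, rfl⟩
  obtain ⟨B, c, hB, hn⟩ := Nat.find_spec hex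
  refine ⟨B, c, hB, fun B' c' hB' => ?_⟩
  rw [hn]
  exact Nat.find_min' hex ⟨B', c', hB', rfl⟩

variable [Finite V]

/-- Deleting one vertex from a minimal lump leaves it connected. -/
theorem IsMinimalLump.exists_adj_of_ssubset {B : Set V} {c : V} (h : IsMinimalLump G B c) {d : V}
    (hd : d ∈ B) {Y : Set V} (hYB : Y ⊆ B) (hdY : d ∉ Y) (hY : Y.Nonempty) {z : V} (hz : z ∈ B)
    (hzd : z ≠ d) (hzY : z ∉ Y) : ∃ u ∈ Y, ∃ w ∈ B, w ≠ d ∧ w ∉ Y ∧ G.Adj u w := by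
  by_contra hcon
  push Not at hcon
  -- If no edge leaves `Y` except to `d`, then `B \ Y` or `insert d Y`, according as `c` is in `Y`
  -- or not, is a smaller lump with cut vertex `d`.
  by_cases hc : c ∈ Y
  · have hl : IsLump G (B \ Y) d := by
      refine ⟨⟨hd, hdY⟩, ⟨z, ⟨hz, hzY⟩, hzd⟩, fun v hv hvd u hvu => ⟨?_, ?_⟩, fun v hv hvd => ?_⟩
      · exact h.closed v hv.1 (by rintro rfl; exact hv.2 hc) u hvu
      · exact fun hu => hcon u hu v hv.1 hvd hv.2 hvu.symm
      · exact h.exists_adj v hv.1 (by rintro rfl; exact hv.2 hc)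
    have h1 := h.le _ _ hl
    have h2 : (B \ Y).ncard < B.ncard :=
      Set.ncard_lt_ncard ⟨Set.sdiff_subset, fun hs => (hs (hYB hc)).2 hc⟩
    omega
  · have hl : IsLump G (insert d Y) d := by
      refine ⟨Or.inl rfl, ?_, ?_, ?_⟩
      · obtain ⟨y, hy⟩ := hY
        exact ⟨y, Or.inr hy, by rintro rfl; exact hdY hy⟩
      · intro v hv hvd u hvu
        have hvY := hv.resolve_left hvd
        by_contra hu
        simp only [Set.mem_insert_iff, not_or] at hu
        exact hcon v hvY u (h.closed v (hYB hvY) (by rintro rfl; exact hc hvY) u hvu) hu.1 hu.2 hvu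
      · intro v hv hvd
        have hvY := hv.resolve_left hvd
        exact h.exists_adj v (hYB hvY) (by rintro rfl; exact hc hvY)
    have h1 := h.le _ _ hl
    have h2 : (insert d Y).ncard < B.ncard := by
      refine Set.ncard_lt_ncard ⟨?_, fun hs => ?_⟩
      · rintro x (rfl | hx)
        · exact hd
        · exact hYB hx
      · exact (hs hz).elim hzd hzY
    omega

/-- A longest circuit of a minimal lump has no neighbours in the rest of the lump. -/
theorem IsMinimalLump.not_adj_of_longest (hG : ThetaFree G) {B : Set V} {c : V}
    (h : IsMinimalLump G B c) {a : V} {t : List V} (hC : IsCircuit G (a :: t))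
    (hB : ∀ x ∈ a :: t, x ∈ B)
    (hmax : ∀ L, IsCircuit G L → (∀ x ∈ L, x ∈ B) → L.length ≤ (a :: t).length) {w : V}
    (hw : w ∈ B) (hwC : w ∉ a :: t) : ¬ G.Adj a w := by
  intro haw
  set H := isolate G {v | v ∈ a :: t ∨ v ∉ B} with hH
  have hHG : H ≤ G := fun u v huv => huv.1
  -- The component of `w` in the lump without the circuit. Since `a` does not separate the lump, `Y`
  -- has a neighbour `z ≠ a` on the circuit.
  set Y : Set V := {u | H.Reachable w u}
  have hYout : ∀ u ∈ Y, u ∈ B ∧ u ∉ a :: t := by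
    rintro u ⟨p⟩
    rcases eq_or_ne u w with rfl | hne
    · exact ⟨hw, hwC⟩
    · have hnil : ¬ p.reverse.Nil := SimpleGraph.Walk.not_nil_of_ne hne
      have := (p.reverse.adj_snd hnil).2.1
      simp only [Set.mem_ofPred_eq, not_or, not_not] at this
      exact ⟨this.2, this.1⟩
  obtain ⟨z₀, hz₀⟩ : ∃ z, z ∈ t := by
    have := hC.2.1
    rcases t with _ | ⟨z, t⟩
    · simp at this
    · exact ⟨z, by simp⟩
  have hnd := hC.1
  obtain ⟨u, hu, z, hz, hza, hzY, huz⟩ := h.exists_adj_of_ssubset (hB a (by simp))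
    (fun u hu => (hYout u hu).1) (fun ha => (hYout a ha).2 (by simp)) ⟨w, SimpleGraph.Reachable.refl w⟩
    (hB z₀ (by simp [hz₀])) (by rintro rfl; simp [hz₀] at hnd)
    (fun hz => (hYout z₀ hz).2 (by simp [hz₀]))
  have hzt : z ∈ t := by
    by_contra hzt
    have hadj : H.Adj u z := by
      refine ⟨huz, ?_, ?_⟩
      · simp only [Set.mem_ofPred_eq, not_or, not_not]
        exact ⟨(hYout u hu).2, (hYout u hu).1⟩
      · simp only [Set.mem_ofPred_eq, not_or, not_not]
        exact ⟨by simp [hza, hzt], hz⟩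
    exact hzY (SimpleGraph.Reachable.trans hu hadj.reachable)
  obtain ⟨s, hs0, hsnd, hsY, hchain⟩ := exists_isChain_of_reachable hHG hu haw huz
  have hsB : ∀ x ∈ s, x ∈ B := fun x hx => (hYout x (hsY x hx)).1
  have hsC : ∀ x ∈ s, x ∉ a :: t := fun x hx => (hYout x (hsY x hx)).2
  have hslen : 0 < s.length := List.length_pos_iff.2 hs0
  obtain ⟨t₁, t₂, rfl⟩ := List.append_of_mem hzt
  have hcirc := hC.isChain
  have hc1 : List.IsChain G.Adj ((a :: t₁) ++ z :: (t₂ ++ [a])) := by simpa using hcirc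
  rw [List.isChain_split] at hc1
  have hall : (s ++ (a :: (t₁ ++ z :: t₂))).Nodup := by
    rw [List.nodup_append]
    refine ⟨hsnd, hnd, ?_⟩
    rintro x hx y hy rfl
    exact hsC x hx hy
  -- If `z` is next to `a` on the circuit, the detour through `Y` gives a longer circuit; otherwise
  -- the detour and the two halves of the circuit form a theta.
  rcases eq_or_ne t₁ [] with rfl | h₁
  · have hlong : IsCircuit G (a :: (s ++ z :: t₂)) := by
      refine ⟨?_, by simp; omega, a, _, rfl, ?_⟩
      · refine (List.Perm.nodup_iff ?_).1 hall
        simp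
      · have : List.IsChain G.Adj ((a :: s) ++ z :: (t₂ ++ [a])) := by
          rw [List.isChain_split]
          exact ⟨hchain, hc1.2⟩
        simpa using this
    have := hmax _ hlong (by
      intro x hx
      simp only [List.mem_cons, List.mem_append] at hx
      rcases hx with rfl | hx | hx
      · exact hB _ (by simp)
      · exact hsB x hx
      · exact hB x (by simp [hx]))
    simp only [List.length_cons, List.length_append, List.length_nil] at this
    omega
  · rcases eq_or_ne t₂ [] with rfl | h₂
    · have hlong : IsCircuit G (a :: (t₁ ++ z :: s.reverse)) := by
        refine ⟨?_, by simp; omega, a, _, rfl, ?_⟩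
        · refine (List.Perm.nodup_iff ?_).1 hall
          classical
          rw [List.perm_iff_count]
          intro x
          simp [List.count_cons, List.count_append]
          omega
        · have : List.IsChain G.Adj ((a :: t₁) ++ z :: (s.reverse ++ [a])) := by
            rw [List.isChain_split]
            refine ⟨hc1.1, ?_⟩
            simpa using isChain_reverse_of_isChain hchain
          simpa using this
      have := hmax _ hlong (by
        intro x hx
        simp only [List.mem_cons, List.mem_append, List.mem_reverse] at hx
        rcases hx with rfl | hx | rfl | hx
        · exact hB _ (by simp)
        · exact hB x (by simp [hx])
        · exact hz
        · exact hsB x hx)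
      simp only [List.length_cons, List.length_append, List.length_reverse, List.length_nil] at this
      omega
    · refine hG a z t₁ t₂.reverse s h₁ (by simpa using h₂) hs0 hc1.1 ?_ hchain ?_
      · simpa using isChain_reverse_of_isChain hc1.2
      · refine (List.Perm.nodup_iff ?_).1 hall
        classical
        rw [List.perm_iff_count]
        intro x
        simp [List.count_cons, List.count_append]
        omega

/-- A minimal lump of a graph without thetas has a Hamiltonian circuit. -/
theorem IsMinimalLump.exists_hamiltonian (hG : ThetaFree G) {B : Set V} {c : V}
    (h : IsMinimalLump G B c) : ∃ t, IsCircuit G (c :: t) ∧ ∀ x, x ∈ c :: t ↔ x ∈ B := by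
  classical
  obtain ⟨L, hL, hLB, hmax⟩ : ∃ L, IsCircuit G L ∧ (∀ x ∈ L, x ∈ B) ∧
      ∀ L', IsCircuit G L' → (∀ x ∈ L', x ∈ B) → L'.length ≤ L.length := by
    by_contra hcon
    push Not at hcon
    have hall : ∀ n, ∃ L, IsCircuit G L ∧ (∀ x ∈ L, x ∈ B) ∧ n ≤ L.length := by
      intro n
      induction n with
      | zero =>
        obtain ⟨v, hv, hvc⟩ := h.exists_ne
        obtain ⟨u, hu⟩ := h.exists_adj v hv hvc
        refine ⟨[v, u], ⟨by simp [hu.ne], by simp, v, [u], rfl, by simp [hu, hu.symm]⟩, ?_, by simp⟩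
        simp only [List.mem_cons, List.not_mem_nil, or_false]
        rintro x (rfl | rfl)
        · exact hv
        · exact h.closed v hv hvc _ hu
      | succ n ih =>
        obtain ⟨L, hL, hLB, hn⟩ := ih
        obtain ⟨L', hL', hLB', hlt⟩ := hcon L hL hLB
        exact ⟨L', hL', hLB', by omega⟩
    have := Fintype.ofFinite V
    obtain ⟨L, hL, _, hn⟩ := hall (Fintype.card V + 1)
    have := hL.1.length_le_card
    omega
  have hcover : ∀ x ∈ B, x ∈ L := by
    intro x hx
    by_contra hxL
    have hnd := hL.1
    obtain ⟨h2, a, t, rfl, _⟩ := hL.2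
    have hat : a ∉ t := (List.nodup_cons.1 hnd).1
    obtain ⟨y, hy⟩ : ∃ y, y ∈ t := by
      rcases t with _ | ⟨y, t⟩
      · simp at h2
      · exact ⟨y, by simp⟩
    -- A missed vertex yields an edge leaving the circuit at some `u`; rotating the circuit to start
    -- at `u` contradicts its maximality.
    obtain ⟨u, hu, w, hw, hwa, hwt, huw⟩ := h.exists_adj_of_ssubset (d := a) (Y := {v | v ∈ t})
      (hLB a (by simp)) (fun v hv => hLB v (List.mem_cons_of_mem _ hv)) hat ⟨y, hy⟩ hx
      (by rintro rfl; simp at hxL) (fun hxt => hxL (List.mem_cons_of_mem _ hxt))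
    obtain ⟨l₁, l₂, hl⟩ := List.append_of_mem (List.mem_cons_of_mem a hu : u ∈ a :: t)
    rw [hl] at hL hLB hmax
    have hmem : ∀ x, x ∈ u :: (l₂ ++ l₁) ↔ x ∈ a :: t := by
      intro x; rw [hl]; simp; tauto
    refine h.not_adj_of_longest hG (a := u) (t := l₂ ++ l₁) hL.rotate ?_ ?_ hw ?_ huw
    · intro x hx
      apply hLB
      rw [← hl]
      exact (hmem x).1 hx
    · intro L' hL' hLB'
      refine (hmax L' hL' hLB').trans ?_
      simp; omega
    · rw [hmem]
      simp only [List.mem_cons, not_or]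
      exact ⟨hwa, hwt⟩
  obtain ⟨l₁, l₂, rfl⟩ := List.append_of_mem (hcover c h.mem)
  refine ⟨l₂ ++ l₁, hL.rotate, fun x => ⟨fun hx => hLB x ?_, fun hx => ?_⟩⟩
  · simp at hx ⊢; tauto
  · have := hcover x hx
    simp at this ⊢; tauto

theorem List.exists_eq_append_of_lt {α : Type*} (L : List α) {i j k l : ℕ} (hij : i < j)
    (hjk : j < k) (hkl : k < l) (hl : l < L.length) : ∃ l₀ l₁ l₂ l₃ l₄ : List α,
      L = l₀ ++ L[i] :: (l₁ ++ L[j] :: (l₂ ++ L[k] :: (l₃ ++ L[l] :: l₄))) := by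
  refine ⟨L.take i, (L.drop (i + 1)).take (j - i - 1), (L.drop (j + 1)).take (k - j - 1),
    (L.drop (k + 1)).take (l - k - 1), L.drop (l + 1), ?_⟩
  have key : ∀ a b (hab : a < b) (hb : b < L.length),
      L.drop (a + 1) = (L.drop (a + 1)).take (b - a - 1) ++ L[b] :: L.drop (b + 1) := by
    intro a b hab hb
    conv_lhs => rw [← List.take_append_drop (b - a - 1) (L.drop (a + 1))]
    rw [List.drop_drop, show a + 1 + (b - a - 1) = b by omega, List.drop_eq_getElem_cons hb]
  rw [← key k l hkl hl, ← key j k hjk (by omega), ← key i j hij (by omega),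
    ← List.drop_eq_getElem_cons, List.take_append_drop]

/-- The circuit of a minimal lump has two vertices and gives a leaf, or has no crossing chords, or
spans a K4. -/
theorem IsMinimalBad.false (h : IsMinimalBad G) : False := by
  classical
  obtain ⟨B, c, hB⟩ := h.exists_isMinimalLump
  obtain ⟨t, hC, hmem⟩ := hB.exists_hamiltonian h.thetaFree
  have hnd := hC.1
  set L := c :: t with hL
  have hlen : 2 ≤ L.length := hC.2.1
  rcases Nat.eq_or_lt_of_le hlen with h2 | h3
  · obtain ⟨x, rfl⟩ : ∃ x, t = [x] := by
      rw [hL, List.length_cons] at h2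
      exact List.length_eq_one_iff.1 (by omega)
    have hxc : x ≠ c := by rintro rfl; simp [hL] at hnd
    have hx : x ∈ B := (hmem x).1 (by simp [hL])
    obtain ⟨u, hu⟩ := hB.exists_adj x hx hxc
    have hN : ∀ u, G.Adj x u → u = c := by
      intro u hu
      have := (hmem u).2 (hB.closed x hx hxc u hu)
      simp only [hL, List.mem_cons, List.not_mem_nil, or_false] at this
      exact this.resolve_right hu.ne'
    exact h.false_of_leaf (hN u hu ▸ hu) hN
  have hget : ∀ k (hk : k < L.length), L.getD k c = L[k] := fun k hk => List.getD_eq_getElem _ _ hk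
  have hchain := hC.isChain
  rw [← hL] at hchain
  have hpath : ∀ k, k + 1 < L.length → G.Adj (L.getD k c) (L.getD (k + 1) c) := by
    intro k hk
    rw [hget k (by omega), hget (k + 1) hk]
    have := (List.isChain_append.1 hchain).1
    exact List.isChain_iff_getElem.1 this k hk
  have hinj : ∀ k < L.length, ∀ l < L.length, L.getD k c = L.getD l c → k = l := by
    intro k hk l hl he
    rw [hget k hk, hget l hl] at he
    exact (hnd.getElem_inj_iff).1 he
  refine h.false_of_hamiltonian_block (fun k => L.getD k c) h3 hinj hpath ?_ ?_ ?_
  · have := List.isChain_iff_getElem.1 hchain (L.length - 1) (by simp; omega)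
    rw [List.getElem_append_left (by omega), List.getElem_append_right (by omega)] at this
    simp only [List.getElem_singleton] at this
    change G.Adj c (L.getD (L.length - 1) c)
    rw [hget _ (by omega)]
    exact this.symm
  · intro k hk0 hk u hu
    change G.Adj (L.getD k c) u at hu
    have hkc : L.getD k c ≠ c := fun he => by
      have := hinj k hk 0 (by omega) he
      omega
    have hkB : L.getD k c ∈ B := by
      rw [hget k hk]; exact (hmem _).1 (List.getElem_mem hk)
    obtain ⟨l, hl, hlu⟩ := List.getElem_of_mem ((hmem u).2 (hB.closed _ hkB hkc u hu))
    exact ⟨l, hl, by rw [← hlu]; exact (hget l hl).symm⟩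
  · intro i j k l hij hjk hkl hl hik hjl
    change G.Adj (L.getD i c) (L.getD k c) at hik
    change G.Adj (L.getD j c) (L.getD l c) at hjl
    rw [hget i (by omega), hget k (by omega)] at hik
    rw [hget j (by omega), hget l (by omega)] at hjl
    obtain ⟨l₀, l₁, l₂, l₃, l₄, hdec⟩ := L.exists_eq_append_of_lt hij hjk hkl hl
    generalize L[i] = a at *
    generalize L[j] = b at *
    generalize L[k] = d at *
    generalize L[l] = e at *
    have r0 := hC
    rw [hdec] at r0
    have r1 : IsCircuit G (a :: l₁ ++ b :: l₂ ++ d :: l₃ ++ e :: (l₄ ++ l₀)) := by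
      simpa using r0.rotate
    -- From each of the four ends in turn, the arc up to the next end is empty. So the lump is a K4,
    -- which contains no theta and needs its own reduction.
    have e1 := r1.eq_nil_of_crossing h.thetaFree hik hjl
    have r2 : IsCircuit G (b :: l₂ ++ d :: l₃ ++ e :: (l₄ ++ l₀) ++ a :: l₁) := by
      have : IsCircuit G ((a :: l₁) ++ b :: (l₂ ++ d :: l₃ ++ e :: (l₄ ++ l₀))) := by
        simpa using r1
      simpa using this.rotate
    have e2 := r2.eq_nil_of_crossing h.thetaFree hjl hik.symm
    have r3 : IsCircuit G (d :: l₃ ++ e :: (l₄ ++ l₀) ++ a :: l₁ ++ b :: l₂) := by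
      have : IsCircuit G ((b :: l₂) ++ d :: (l₃ ++ e :: (l₄ ++ l₀) ++ a :: l₁)) := by
        simpa using r2
      simpa using this.rotate
    have e3 := r3.eq_nil_of_crossing h.thetaFree hik.symm hjl.symm
    have r4 : IsCircuit G (e :: (l₄ ++ l₀) ++ a :: l₁ ++ b :: l₂ ++ d :: l₃) := by
      have : IsCircuit G ((d :: l₃) ++ e :: ((l₄ ++ l₀) ++ a :: l₁ ++ b :: l₂)) := by
        simpa using r3
      simpa using this.rotate
    have e4 := r4.eq_nil_of_crossing h.thetaFree hjl.symm hik
    obtain ⟨e5, e6⟩ := List.append_eq_nil_iff.1 e4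
    subst e1 e2 e3 e5 e6
    have hch : List.IsChain G.Adj (a :: [b, d, e] ++ [a]) := IsCircuit.isChain (by simpa using r1)
    simp only [List.cons_append, List.nil_append, List.isChain_cons_cons,
      List.isChain_singleton, and_true] at hch
    obtain ⟨hab, hbd, hde, hea⟩ := hch
    have hB4 : ∀ x, x ∈ B ↔ x = a ∨ x = b ∨ x = d ∨ x = e := by
      intro x
      rw [← hmem, hdec]
      simp
    have hclique : ∀ x ∈ B, ∀ y ∈ B, x ≠ y → G.Adj x y := by
      intro x hx y hy hxy
      rcases (hB4 x).1 hx with rfl | rfl | rfl | rfl <;>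
        rcases (hB4 y).1 hy with rfl | rfl | rfl | rfl <;>
        first
        | exact absurd rfl hxy
        | assumption
        | (apply SimpleGraph.Adj.symm; assumption)
    obtain ⟨v, hv, hvc⟩ := hB.exists_ne
    refine h.false_of_sq_subset (hclique v hv c hB.mem hvc) ?_ ?_
    · intro x y hx hy hxy
      exact hclique x (hB.closed v hv hvc x hx) y (hB.closed v hv hvc y hy) hxy
    · have hmemB : ∀ u ∈ B, u = c ∨ G.Adj c u := by
        intro u hu
        by_cases huc : u = c
        · exact Or.inl huc
        · exact Or.inr (hclique c hB.mem u hu (Ne.symm huc))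
      rintro u ⟨_, h1 | ⟨w, h1, h2⟩⟩
      · exact hmemB u (hB.closed v hv hvc u h1)
      · have hw := hB.closed v hv hvc w h1
        by_cases hwc : w = c
        · subst hwc
          exact Or.inr h2
        · exact hmemB u (hB.closed w hw hwc u h2)

end Lumps

/-! ### Induction over subgraphs and conclusion. -/

theorem ThetaFree.mono {V : Type*} {G G' : SimpleGraph V} (h : ThetaFree G) (hle : G' ≤ G) :
    ThetaFree G' := by
  intro x y l₁ l₂ l₃ h₁ h₂ h₃ c₁ c₂ c₃
  exact h x y l₁ l₂ l₃ h₁ h₂ h₃ (c₁.imp fun _ _ h => hle h) (c₂.imp fun _ _ h => hle h)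
    (c₃.imp fun _ _ h => hle h)

/-- Both hypotheses pass to subgraphs, so well-founded induction on `<` supplies the minimality in
`IsMinimalBad`. -/
theorem ThetaFree.sqColorable {V : Type*} [Finite V] (G : SimpleGraph V) :
    ThetaFree G → (∀ v, (G.neighborSet v).ncard ≤ 4) → SqColorable G := by
  induction G using WellFoundedLT.induction with
  | _ G ih =>
    intro hG hdeg
    by_contra hcon
    refine IsMinimalBad.false (G := G) ⟨hdeg, hG, fun G' hlt => ?_, hcon⟩
    refine ih G' hlt (hG.mono hlt.le) fun v => ?_
    exact (Set.ncard_le_ncard fun u hu => hlt.le hu).trans (hdeg v)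

theorem mainTheorem7 {V : Type*} [Fintype V] (G : SimpleGraph V) [DecidableRel G.Adj]
    (hG : IsOuterplanar G) (hΔ : G.maxDegree = 4) :
    (graphSquare G).chromaticNumber ≤ 6 := by
  obtain ⟨c, hc⟩ := hG.thetaFree.sqColorable G (fun v => by
    rw [Set.ncard_eq_toFinset_card', ← hΔ]
    exact G.degree_le_maxDegree v)
  refine SimpleGraph.Colorable.chromaticNumber_le (n := 6) ⟨SimpleGraph.Coloring.mk c ?_⟩
  intro u v huv
  exact hc u trivial v trivial huv
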